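/- \textbf{Model.} Constants: $\lambda,\rho,P_{\rm u}^{(\rm M)},P_{\rm d},B_{\rm d}^{\rm HD},B_{\rm u}^{\rm HD}>0$, $\eta>2$, $\epsilon\ge 0$, $\alpha\in[0,1]$, $\beta_{\rm d},\beta_{\rm u}\ge 0$, pulse types $b_{\rm d},b_{\rm u}\in\{R,T\}$. Put $\mathrm{SINC}(x)=\frac{\sin \pi x}{\pi x}$ and $$S(f,W,R)=\frac{\mathrm{SINC}(2f/W)}{\sqrt{\int_{\mathbb R}\mathrm{SINC}^2(2g/W)\,dg}},\qquad S(f,W,T)=\frac{\mathrm{SINC}^2(2f/W)}{\sqrt{\int_{\mathbb R}\mathrm{SINC}^4(2g/W)\,dg}}.$$ With $B=\min(B_{\rm d}^{\rm HD},B_{\rm u}^{\rm HD})$, for $v\in\{{\rm d},{\rm u}\}$ and $\bar v$ the other direction, let $B_v=B_v^{\rm HD}+\alpha(\epsilon+1)B$, $\Delta f=\frac12\big(B_{\rm d}^{\rm HD}+B_{\rm u}^{\rm HD}+2\epsilon B-2\alpha B(\epsilon+1)\big)$, and $$\mathcal I_v=\int_{-B_v/2}^{B_v/2}S(f,B_v,b_v)^2\,df,\qquad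 \mathcal C_v=\int_{-B_v/2}^{B_v/2}S(f,B_v,b_v)\,S(f-\Delta f,B_{\bar v},b_{\bar v})\,df .$$ Let $R_{\rm M}=(P_{\rm u}^{(\rm M)}/\rho)^{1/\eta}$. The test receiver is at the origin of $\mathbb R^2$. The interfering base stations (BSs) $\{x_k\}$ and the interfering users (UEs) $\{y_j\}$ form two independent homogeneous Poisson point processes of intensity $\lambda$. All channel power gains are exponential with mean $1$. The distance $R$ of an active user to its own BS is distributed as the distance from the origin to the nearest point of a Poisson process of intensity $\lambda$, conditioned on $\rho R^\eta\le P_{\rm u}^{(\rm M)}$, and its transmit power is $P_{\rm u}=\rho R^{\eta}$; the interfering users have i.i.d. distances $R_j$ with this law and powers $P_{{\rm u}_j}=\rho R_j^\eta$. An interfering user contributes only if its average power received at the origin is below $\rho$, i.e. if $P_{{\rm u}_j}\|y_j\|^{-\eta}<\rho$. The normalized self-interference attenuation $h_{\rm s}\ge0$ has mean $1$ and law $F_{H_{\rm s}}$ (with density $f_{H_{\rm s}}$, so $dF_{H_{\rm s}}(h)=f_{H_{\rm s}}(h)\,dh$, or degenerate). Both processes, all gains, all the distances $R_j$, $h_{\rm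 s}$, and the distance, direction and gain of the user $y'$ introduced below are jointly independent. \emph{Downlink.} The test user is served by a BS at a point at distance $r_o>0$, and interfering BSs at distance at most $r_o$ are excluded. Its aggregate interference is $$I_{\rm d}=|\mathcal I_{\rm d}|^2\sum_{k:\|x_k\|>r_o}P_{\rm d}h_k\|x_k\|^{-\eta}+|\mathcal C_{\rm d}|^2\sum_{j:\,P_{{\rm u}_j}\|y_j\|^{-\eta}<\rho}P_{{\rm u}_j}h_j\|y_j\|^{-\eta}+T,$$ where in the two-node topology (2NT) $T=\beta_{\rm d}h_{\rm s}\rho r_o^{\eta}|\mathcal C_{\rm d}|^2$, and in the three-node topology (3NT) $T=|\mathcal C_{\rm d}|^2\,\rho R'^{\eta}h'\|y'\|^{-\eta}$, where $y'$ is the uplink user of the test cell, at distance $R'$ (with the law of $R$) and in a uniformly distributed direction from the serving BS. \emph{Uplink.} The test receiver is a BS, and for both topologies $$I_{\rm u}=|\mathcal I_{\rm u}|^2\sum_{j:\,P_{{\rm u}_j}\|y_j\|^{-\eta}<\rho}P_{{\rm u}_j}h_j\|y_j\|^{-\eta}+|\mathcal C_{\rm u}|^2\sum_{k}P_{\rm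 d}h_k\|x_k\|^{-\eta}+\beta_{\rm u}h_{\rm s}P_{\rm d}|\mathcal C_{\rm u}|^2 .$$ \textbf{Lemma.} The sums over the interferers converge almost surely. The law of $R$ has density, on $(0,R_{\rm M}]$, $$f_R(r)=\frac{2\pi\lambda r\,e^{-\pi\lambda r^2}}{1-e^{-\pi\lambda R_{\rm M}^2}},\qquad\text{and}\qquad \mathbb E\big[P_{\rm u}^{2/\eta}\big]=\frac{\rho^{2/\eta}\,\gamma(2,\pi\lambda R_{\rm M}^2)}{\pi\lambda\,(1-e^{-\pi\lambda R_{\rm M}^2})},$$ with $\gamma(a,x)=\int_0^xt^{a-1}e^{-t}dt$. Write $F(z)={}_2F_1\big[1,1-\tfrac2\eta;2-\tfrac2\eta;z\big]$ for $z\le 0$ (analytically continued beyond the unit disc). For all $s\ge 0$, the Laplace transforms $\mathcal L_{I}(s)=\mathbb E[e^{-sI}]$ are $$\mathcal L_{I_{\rm d}}(s)=\exp\Big(\tfrac{-2\pi\lambda}{\eta-2}r_o^{2-\eta}|\mathcal I_{\rm d}|^2sP_{\rm d}\,F\big(-r_o^{-\eta}P_{\rm d}|\mathcal I_{\rm d}|^2s\big)\Big)\exp\Big(\tfrac{-2\pi\lambda\rho^{1-2/\eta}}{\eta-2}\,\mathbb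 E\big[P_{\rm u}^{2/\eta}\big]|\mathcal C_{\rm d}|^2s\,F\big(-\rho|\mathcal C_{\rm d}|^2s\big)\Big)U_1(r_o,s)\,U_2(r_o,s),$$ $$\mathcal L_{I_{\rm u}}(s)=\exp\Big(\tfrac{-2\pi\lambda\rho^{1-2/\eta}}{\eta-2}\,\mathbb E\big[P_{\rm u}^{2/\eta}\big]|\mathcal I_{\rm u}|^2s\,F\big(-\rho|\mathcal I_{\rm u}|^2s\big)\Big)\exp\Big(-\tfrac{2\pi^2\lambda}{\eta}\big(s|\mathcal C_{\rm u}|^2P_{\rm d}\big)^{2/\eta}\csc\tfrac{2\pi}{\eta}\Big)U_3(s),$$ where $U_1=1$ for 2NT, $U_2=1$ for 3NT, and $$U_1(r_o,s)=\int_0^{R_{\rm M}}\!\!\int_0^{\pi}\frac{f_R(r)\,d\theta\,dr}{\pi+\pi s|\mathcal C_{\rm d}|^2\rho\big(1+(\frac{r_o}{r})^2-2\frac{r_o}{r}\cos\theta\big)^{-\eta/2}}\quad\text{(3NT)},$$ $$U_2(r_o,s)=\int_{[0,\infty)}e^{-\beta_{\rm d}sh\rho r_o^{\eta}|\mathcal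 C_{\rm d}|^2}\,dF_{H_{\rm s}}(h)\quad\text{(2NT)},\qquad U_3(s)=\int_{[0,\infty)}e^{-\beta_{\rm u}shP_{\rm d}|\mathcal C_{\rm u}|^2}\,dF_{H_{\rm s}}(h).$$ -/

import Mathlib

open MeasureTheory ProbabilityTheory
open scoped ENNReal NNReal

noncomputable section

/-! ### Special functions -/

/-- Gauss hypergeometric function `₂F₁(a, b; c; z)` for real parameters `0 < b < c` and real
`z < 1`, through Euler's integral. (The power series represents this function only for `|z| < 1`,
whereas arguments `z ≤ -1` are needed.) -/
def gaussHyp (a b c z : ℝ) : ℝ :=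
  Real.Gamma c / (Real.Gamma b * Real.Gamma (c - b)) *
    ∫ t in (0 : ℝ)..1, t ^ (b - 1) * (1 - t) ^ (c - b - 1) * (1 - z * t) ^ (-a)

/-- On the disc of convergence `gaussHyp` is the hypergeometric power series (for the parameters
that occur below). -/
theorem gaussHyp_eq_series {b z : ℝ} (hb : 0 < b) (hz : |z| < 1) :
    gaussHyp 1 b (b + 1) z = ₂F₁ 1 b (b + 1) z := by
  have hpoch : ∀ n : ℕ, (ascPochhammer ℝ n).eval b * (b + n) =
      (ascPochhammer ℝ n).eval (b + 1) * b := by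
    intro n
    induction n with
    | zero => simp
    | succ n ih =>
      rw [ascPochhammer_succ_eval, ascPochhammer_succ_eval]
      push_cast
      linear_combination (b + n + 1) * ih
  have hsum : HasSum (fun n : ℕ => ∫ t in (0 : ℝ)..1, t ^ (b - 1) * (z * t) ^ n)
      (∫ t in (0 : ℝ)..1, t ^ (b - 1) * (1 - z * t)⁻¹) := by
    refine intervalIntegral.hasSum_integral_of_dominated_convergence
      (bound := fun n t => t ^ (b - 1) * |z| ^ n) ?_ ?_ ?_ ?_ ?_
    · intro n
      exact (Measurable.aestronglyMeasurable (by fun_prop))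
    · intro n
      refine Filter.Eventually.of_forall fun t ht => ?_
      rw [Set.uIoc_of_le zero_le_one] at ht
      rw [norm_mul, norm_pow, norm_mul, Real.norm_of_nonneg (Real.rpow_nonneg ht.1.le _),
        Real.norm_of_nonneg ht.1.le, Real.norm_eq_abs]
      have h1 : |z| * t ≤ |z| := mul_le_of_le_one_right (abs_nonneg z) ht.2
      have h2 := Real.rpow_nonneg ht.1.le (b - 1)
      have h3 := mul_nonneg (abs_nonneg z) ht.1.le
      gcongr
    · refine Filter.Eventually.of_forall fun t _ => ?_
      exact (summable_geometric_of_lt_one (abs_nonneg z) hz).mul_left _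
    · have h : IntervalIntegrable (fun t : ℝ => t ^ (b - 1)) MeasureTheory.volume 0 1 :=
        intervalIntegral.intervalIntegrable_rpow' (by linarith)
      have h2 := h.mul_const (∑' n : ℕ, |z| ^ n)
      refine h2.congr ?_
      intro t _
      exact tsum_mul_left.symm
    · refine Filter.Eventually.of_forall fun t ht => ?_
      rw [Set.uIoc_of_le zero_le_one] at ht
      have h1 : ‖z * t‖ < 1 := by
        rw [norm_mul, Real.norm_of_nonneg ht.1.le, Real.norm_eq_abs]
        exact lt_of_le_of_lt (mul_le_of_le_one_right (abs_nonneg z) ht.2) hz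
      have h2 : HasSum (fun n : ℕ => (z * t) ^ n) (1 - z * t)⁻¹ :=
        hasSum_geometric_of_norm_lt_one h1
      exact HasSum.mul_left (t ^ (b - 1)) h2
  have hint : ∀ n : ℕ, ∫ t in (0 : ℝ)..1, t ^ (b - 1) * (z * t) ^ n = z ^ n / (b + n) := by
    intro n
    have : ∀ t ∈ Set.uIoc (0 : ℝ) 1, t ^ (b - 1) * (z * t) ^ n = z ^ n * t ^ (b - 1 + n) := by
      intro t ht
      rw [Set.uIoc_of_le zero_le_one] at ht
      rw [mul_pow, Real.rpow_add_natCast ht.1.ne']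
      ring
    rw [intervalIntegral.integral_congr_ae (Filter.Eventually.of_forall this),
      intervalIntegral.integral_const_mul, integral_rpow (Or.inl (by
        have : (0 : ℝ) ≤ n := n.cast_nonneg
        linarith))]
    have hn : b + n ≠ 0 := by positivity
    have : b - 1 + n + 1 = b + n := by ring
    rw [this, Real.zero_rpow hn]
    simp [div_eq_mul_inv]
  have hser : HasSum (fun n : ℕ => b * (z ^ n / (b + n))) (gaussHyp 1 b (b + 1) z) := by
    have : gaussHyp 1 b (b + 1) z = b * ∫ t in (0 : ℝ)..1, t ^ (b - 1) * (1 - z * t)⁻¹ := by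
      have hg := (Real.Gamma_pos_of_pos hb).ne'
      simp only [gaussHyp, add_sub_cancel_left, sub_self, Real.rpow_zero, mul_one,
        Real.Gamma_one, Real.rpow_neg_one, Real.Gamma_add_one hb.ne']
      field_simp
    rw [this]
    simpa only [hint] using hsum.mul_left b
  rw [← hser.tsum_eq, ordinaryHypergeometric_eq_tsum]
  refine tsum_congr fun n => ?_
  have h1 : (ascPochhammer ℝ n).eval (b + 1) ≠ 0 := (ascPochhammer_pos n _ (by linarith)).ne'
  have h2 : b + n ≠ 0 := by positivity
  have h3 : (n.factorial : ℝ) ≠ 0 := by positivity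
  simp only [smul_eq_mul, ascPochhammer_eval_one]
  field_simp
  linear_combination (-z ^ n) * hpoch n

/-- The lower incomplete gamma function. -/
def lowerGamma (a x : ℝ) : ℝ := ∫ t in (0 : ℝ)..x, t ^ (a - 1) * Real.exp (-t)

/-- The Laplace transform `s ↦ 𝔼[exp (-s X)]` of a real random variable. -/
def laplaceTransform {Ω : Type*} [MeasurableSpace Ω] (X : Ω → ℝ) (P : Measure Ω) (s : ℝ) : ℝ :=
  ∫ ω, Real.exp (-(s * X ω)) ∂P

/-! ### Poisson point processes -/

/-- The plane, with its Euclidean norm. -/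
abbrev Plane : Type := EuclideanSpace ℝ (Fin 2)

/-- The number of points of the random sequence `X` that lie in `B`. -/
def pointCount {Ω E : Type*} (X : Ω → ℕ → E) (B : Set E) (ω : Ω) : ℕ∞ :=
  {n | X ω n ∈ B}.encard

/-- `X ω 0, X ω 1, …` is a measurable enumeration of the points of a Poisson point process with
intensity measure `μ` (whose total mass is infinite, so that there are infinitely many points):
the number of points in a measurable set of finite intensity is Poisson distributed, and the
numbers of points in disjoint measurable sets are independent. -/
structure IsPoissonProcess {Ω E : Type*} [MeasurableSpace Ω] [MeasurableSpace E]
    (X : Ω → ℕ → E) (μ : Measure E) (P : Measure Ω) : Prop where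
  measurable : Measurable X
  count_law : ∀ B : Set E, MeasurableSet B → μ B ≠ ⊤ →
    HasLaw (pointCount X B) ((poissonMeasure (μ B).toNNReal).map (Nat.cast : ℕ → ℕ∞)) P
  count_indep : ∀ (k : ℕ) (B : Fin k → Set E), (∀ i, MeasurableSet (B i)) →
    Pairwise (fun i j => Disjoint (B i) (B j)) → iIndepFun (fun i => pointCount X (B i)) P

/-- The distance from the origin to the nearest point. -/
def nearestDist {Ω : Type*} (X : Ω → ℕ → Plane) (ω : Ω) : ℝ := ⨅ n, ‖X ω n‖

/-! ### System parameters -/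

/-- Rectangular or triangular pulse (in the time domain). -/
inductive Pulse
  | rectangular
  | triangular

/-- Downlink or uplink. -/
inductive Direction
  | dl
  | ul

/-- The other direction. -/
def Direction.other : Direction → Direction
  | .dl => .ul
  | .ul => .dl

/-- Two-node topology (full-duplex users) or three-node topology (half-duplex users). -/
inductive Topology
  | twoNode
  | threeNode

/-- The constants of the model. -/
structure CellParams where
  /-- intensity of the base stations and of the interfering users -/
  lam : ℝ
  /-- path-loss exponent -/
  eta : ℝ
  /-- target average received power at the serving base station -/
  rho : ℝ
  /-- maximum transmit power of a user -/
  pMax : ℝ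
  /-- transmit power of a base station -/
  pDl : ℝ
  /-- half-duplex bandwidths -/
  bwHD : Direction → ℝ
  /-- guard band fraction -/
  guard : ℝ
  /-- overlap parameter -/
  alpha : ℝ
  /-- pulse shapes -/
  pulse : Direction → Pulse
  /-- mean self-interference attenuation -/
  beta : Direction → ℝ
  /-- law of the normalized self-interference attenuation `h_s`; if it has a density `f`,
  then integrals against it are `∫ f h * … dh` -/
  siLaw : Measure ℝ
  lam_pos : 0 < lam
  two_lt_eta : 2 < eta
  rho_pos : 0 < rho
  pMax_pos : 0 < pMax
  pDl_pos : 0 < pDl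
  bwHD_pos : ∀ v, 0 < bwHD v
  guard_nonneg : 0 ≤ guard
  alpha_nonneg : 0 ≤ alpha
  alpha_le_one : alpha ≤ 1
  beta_nonneg : ∀ v, 0 ≤ beta v
  siLaw_prob : IsProbabilityMeasure siLaw
  siLaw_nonneg : ∀ᵐ h ∂siLaw, 0 ≤ h
  siLaw_mean : ∫ h, h ∂siLaw = 1

/-! ### Pulse shapes and effective received energy factors -/

/-- The normalized cardinal sine `sin (π x) / (π x)`. -/
def SINC (x : ℝ) : ℝ := Real.sinc (Real.pi * x)

/-- The (real) Fourier transform at frequency `f` of the unit-energy pulse with null-to-null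
bandwidth `bw`. -/
def pulseSpectrum (f bw : ℝ) : Pulse → ℝ
  | .rectangular => SINC (2 * f / bw) / Real.sqrt (∫ g, SINC (2 * g / bw) ^ 2)
  | .triangular => SINC (2 * f / bw) ^ 2 / Real.sqrt (∫ g, SINC (2 * g / bw) ^ 4)

namespace CellParams

variable (p : CellParams)

/-- `B = min (B_d^HD, B_u^HD)`. -/
def bwMin : ℝ := min (p.bwHD .dl) (p.bwHD .ul)

/-- Bandwidth `B_v^{αD} = B_v^HD + α (ε + 1) B`. -/
def bw (v : Direction) : ℝ := p.bwHD v + p.alpha * (p.guard + 1) * p.bwMin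

/-- Difference `Δf` between the downlink and uplink center frequencies. -/
def freqGap : ℝ :=
  (p.bwHD .dl + p.bwHD .ul + 2 * p.guard * p.bwMin
    - 2 * p.alpha * p.bwMin * (p.guard + 1)) / 2

/-- Intra-mode factor `𝓘_v(α)` (the spectra are real, so no conjugate appears). -/
def intraFactor (v : Direction) : ℝ :=
  ∫ f in (-(p.bw v / 2))..(p.bw v / 2),
    pulseSpectrum f (p.bw v) (p.pulse v) * pulseSpectrum f (p.bw v) (p.pulse v)

/-- Cross-mode factor `𝓒_v(α)`. -/
def crossFactor (v : Direction) : ℝ :=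
  ∫ f in (-(p.bw v / 2))..(p.bw v / 2),
    pulseSpectrum f (p.bw v) (p.pulse v) *
      pulseSpectrum (f - p.freqGap) (p.bw v.other) (p.pulse v.other)

/-- `|𝓘_v(α)|²` -/
def intraGain (v : Direction) : ℝ := |p.intraFactor v| ^ 2

/-- `|𝓒_v(α)|²` -/
def crossGain (v : Direction) : ℝ := |p.crossFactor v| ^ 2

/-- The largest link distance `R_M` that channel inversion can serve. -/
def rMax : ℝ := (p.pMax / p.rho) ^ (1 / p.eta)

/-- Intensity measure of the homogeneous Poisson processes. -/
def intensity : Measure Plane := ENNReal.ofReal p.lam • (volume : Measure Plane)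

/-- Channel-inversion transmit power of a user at distance `r` from its base station. -/
def invPower (r : ℝ) : ℝ := p.rho * r ^ p.eta

end CellParams

/-! ### The network -/

/-- The law of the distance between an active user and its base station: the distance from the
origin to the nearest base station, conditioned on the power required by channel inversion not
exceeding the maximum (users that violate this do not transmit). -/
def linkDistLaw (p : CellParams) {Ω : Type*} [MeasurableSpace Ω] (P : Measure Ω)
    (X : Ω → ℕ → Plane) : Measure ℝ :=
  (P[|{ω | p.invPower (nearestDist X ω) ≤ p.pMax}]).map (nearestDist X)

/-- The independent sources of randomness. -/
inductive RandomSource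
  | bsLoc
  | ueLoc
  | bsFade (n : ℕ)
  | ueFade (n : ℕ)
  | ueDist (n : ℕ)
  | cellDist
  | cellAngle
  | cellFade
  | siGain

/-- The random network seen from a test receiver at the origin. The interfering base stations and
the interfering users form independent Poisson processes of intensity `lam`; the power gains of
all channels are independent unit-mean exponential variables. -/
structure CellNetwork (p : CellParams) {Ω : Type*} [MeasurableSpace Ω] (P : Measure Ω) where
  /-- locations of the interfering base stations -/
  bsLoc : Ω → ℕ → Plane
  /-- locations of the interfering users -/
  ueLoc : Ω → ℕ → Plane
  /-- channel gains from the interfering base stations -/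
  bsFade : ℕ → Ω → ℝ
  /-- channel gains from the interfering users -/
  ueFade : ℕ → Ω → ℝ
  /-- distances of the interfering users to their own serving base stations -/
  ueDist : ℕ → Ω → ℝ
  /-- distance from the base station of the test cell to the uplink user of that cell -/
  cellDist : Ω → ℝ
  /-- direction in which that user is seen from its base station -/
  cellAngle : Ω → ℝ
  /-- channel gain from that user -/
  cellFade : Ω → ℝ
  /-- normalized self-interference attenuation -/
  siGain : Ω → ℝ
  bsLoc_poisson : IsPoissonProcess bsLoc p.intensity P
  ueLoc_poisson : IsPoissonProcess ueLoc p.intensity P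
  bsFade_measurable : ∀ n, Measurable (bsFade n)
  ueFade_measurable : ∀ n, Measurable (ueFade n)
  ueDist_measurable : ∀ n, Measurable (ueDist n)
  cellDist_measurable : Measurable cellDist
  cellAngle_measurable : Measurable cellAngle
  cellFade_measurable : Measurable cellFade
  siGain_measurable : Measurable siGain
  bsFade_law : ∀ n, HasLaw (bsFade n) (expMeasure 1) P
  ueFade_law : ∀ n, HasLaw (ueFade n) (expMeasure 1) P
  ueDist_law : ∀ n, HasLaw (ueDist n) (linkDistLaw p P bsLoc) P
  cellDist_law : HasLaw cellDist (linkDistLaw p P bsLoc) P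
  cellAngle_law : pdf.IsUniform cellAngle (Set.Ico 0 (2 * Real.pi)) P
  cellFade_law : HasLaw cellFade (expMeasure 1) P
  siGain_law : HasLaw siGain p.siLaw P
  indep : iIndep (fun i : RandomSource => match i with
    | .bsLoc => MeasurableSpace.comap bsLoc inferInstance
    | .ueLoc => MeasurableSpace.comap ueLoc inferInstance
    | .bsFade n => MeasurableSpace.comap (bsFade n) inferInstance
    | .ueFade n => MeasurableSpace.comap (ueFade n) inferInstance
    | .ueDist n => MeasurableSpace.comap (ueDist n) inferInstance
    | .cellDist => MeasurableSpace.comap cellDist inferInstance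
    | .cellAngle => MeasurableSpace.comap cellAngle inferInstance
    | .cellFade => MeasurableSpace.comap cellFade inferInstance
    | .siGain => MeasurableSpace.comap siGain inferInstance) P

namespace CellNetwork

variable {p : CellParams} {Ω : Type*} [MeasurableSpace Ω] {P : Measure Ω} (N : CellNetwork p P)

/-- Transmit power of the `n`-th interfering user. -/
def uePower (n : ℕ) (ω : Ω) : ℝ := p.invPower (N.ueDist n ω)

/-- Power received at the origin from the `n`-th base station. -/
def bsRx (n : ℕ) (ω : Ω) : ℝ := p.pDl * N.bsFade n ω * ‖N.bsLoc ω n‖ ^ (-p.eta)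

open Classical in
/-- Power received at the origin from the `n`-th base station when the receiver is associated
with a base station at distance `ro`, so that no interferer is closer than `ro`. -/
def bsRxOutside (ro : ℝ) (n : ℕ) (ω : Ω) : ℝ :=
  if ro < ‖N.bsLoc ω n‖ then N.bsRx n ω else 0

open Classical in
/-- Power received at the origin from the `n`-th user. A user whose average received power at the
origin is not below the target `rho` cannot be an interferer. -/
def ueRx (n : ℕ) (ω : Ω) : ℝ :=
  if N.uePower n ω * ‖N.ueLoc ω n‖ ^ (-p.eta) < p.rho then
    N.uePower n ω * N.ueFade n ω * ‖N.ueLoc ω n‖ ^ (-p.eta)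
  else 0

/-- Location of the uplink user of the test cell, whose base station is at `xo`. -/
def cellUserLoc (xo : Plane) (ω : Ω) : Plane :=
  xo + N.cellDist ω • !₂[Real.cos (N.cellAngle ω), Real.sin (N.cellAngle ω)]

/-- Power received at the origin from the uplink user of the test cell. -/
def cellRx (xo : Plane) (ω : Ω) : ℝ :=
  p.invPower (N.cellDist ω) * N.cellFade ω * ‖N.cellUserLoc xo ω‖ ^ (-p.eta)

/-- Aggregate interference at a downlink test user at the origin, served by a base station at
`xo`: intra-mode, cross-mode, and either residual self-interference (two-node topology, the test
user transmits with power `invPower ‖xo‖`) or intra-cell interference (three-node topology). -/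
def interferenceDl (τ : Topology) (xo : Plane) (ω : Ω) : ℝ :=
  p.intraGain .dl * (∑' n, N.bsRxOutside ‖xo‖ n ω) + p.crossGain .dl * (∑' n, N.ueRx n ω) +
    match τ with
    | .twoNode => p.beta .dl * N.siGain ω * p.invPower ‖xo‖ * p.crossGain .dl
    | .threeNode => p.crossGain .dl * N.cellRx xo ω

/-- Aggregate interference at an uplink test base station at the origin: intra-mode, cross-mode
and residual self-interference (for both topologies). -/
def interferenceUl (ω : Ω) : ℝ :=
  p.intraGain .ul * (∑' n, N.ueRx n ω) + p.crossGain .ul * (∑' n, N.bsRx n ω) +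
    p.beta .ul * N.siGain ω * p.pDl * p.crossGain .ul

end CellNetwork

/-! ### The closed forms -/

namespace CellParams

variable (p : CellParams)

/-- `f_R` -/
def distDensity (r : ℝ) : ℝ :=
  2 * Real.pi * p.lam * r * Real.exp (-(Real.pi * p.lam * r ^ 2)) /
    (1 - Real.exp (-(Real.pi * p.lam * p.rMax ^ 2)))

/-- The closed form of `𝔼[P_u ^ (2/η)]`. -/
def powerMoment : ℝ :=
  p.rho ^ (2 / p.eta) * lowerGamma 2 (Real.pi * p.lam * p.rMax ^ 2) /
    (Real.pi * p.lam * (1 - Real.exp (-(Real.pi * p.lam * p.rMax ^ 2))))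

/-- `₂F₁(1, 1 - 2/η; 2 - 2/η; z)` -/
def hyp (z : ℝ) : ℝ := gaussHyp 1 (1 - 2 / p.eta) (2 - 2 / p.eta) z

/-- Intra-cell term. -/
def U1 (τ : Topology) (ro s : ℝ) : ℝ :=
  match τ with
  | .twoNode => 1
  | .threeNode =>
      ∫ r in (0 : ℝ)..p.rMax, ∫ θ in (0 : ℝ)..Real.pi,
        p.distDensity r /
          (Real.pi + Real.pi * s * p.crossGain .dl * p.rho *
            (1 + (ro / r) ^ 2 - 2 * (ro / r) * Real.cos θ) ^ (-p.eta / 2))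

/-- Downlink self-interference term. -/
def U2 (τ : Topology) (ro s : ℝ) : ℝ :=
  match τ with
  | .threeNode => 1
  | .twoNode =>
      ∫ h in Set.Ici (0 : ℝ),
        Real.exp (-(p.beta .dl * s * h * p.rho * ro ^ p.eta * p.crossGain .dl)) ∂p.siLaw

/-- Uplink self-interference term. -/
def U3 (s : ℝ) : ℝ :=
  ∫ h in Set.Ici (0 : ℝ), Real.exp (-(p.beta .ul * s * h * p.pDl * p.crossGain .ul)) ∂p.siLaw

end CellParams

end

/-! The aggregate interference is a function of three independent blocks of randomness: the base
stations with their gains, the users with their distances and gains, and the test cell. Its Laplace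
transform is therefore a product (`integral_exp_neg_interference`), and each factor is computed
separately.

The two sums are governed by the Laplace functional of an independently marked Poisson process, `E
exp(-∑ q(xₙ, mₙ)) = exp(-∫ (1 - E exp(-q(x, m))) μ(dx))`. It is proved for `[0, ∞]`-valued `q`,
where series always converge and `exp(-∞) = 0`, so no summability is presupposed
(`IsPoissonProcess.lintegral_expNeg`, `IsPoissonProcess.lintegral_expNeg_marks`). An exponential
gain turns `E exp(-q)` into `1/(1 + a‖x‖^(-η))`. With `y = ‖x‖^(-η)`, the remaining plane integral
becomes Euler's integral for `₂F₁` when a disc is excluded (`lintegral_plane_outside`), and a beta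
integral, hence a cosecant, on the whole plane (`lintegral_plane_all`).

For a user at distance `r` from its own base station, the condition `ρ r^η ‖y‖^(-η) < ρ` says `r <
‖y‖`: the excluded disc has radius `r`. The argument of `₂F₁` is then free of `r`, because `r^(-η) ·
ρ r^η = ρ`, and the prefactor depends on `r` only through `r²`. Averaging over `r` leaves `E[R²] =
E[P_u^(2/η)] / ρ^(2/η)` (`lintegral_expNeg_ue`).

The law of `R` comes from the void probabilities of discs, truncated by the conditioning
(`linkDistLaw_eq`). Almost sure convergence of the sums follows from the same formulas: as the scale
tends to `0` the transform tends to `1`, which leaves no mass at infinity. The three-node term is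
the law of cosines averaged over a uniform direction (`integral_exp_neg_cellRx`). -/

section LaplaceTransform

open Filter Topology Set

/-! ### The exponential `x ↦ exp (-x)` on `[0, ∞]` -/

/-- The function `x ↦ exp (-x)` on `[0, ∞]`. -/
noncomputable def expNeg (x : ℝ≥0∞) : ℝ≥0∞ := EReal.exp (-(x : EReal))

@[simp] lemma expNeg_zero : expNeg 0 = 1 := by simp [expNeg]

@[simp] lemma expNeg_top : expNeg ⊤ = 0 := by simp [expNeg]

lemma expNeg_add (x y : ℝ≥0∞) : expNeg (x + y) = expNeg x * expNeg y := by
  rw [expNeg, EReal.coe_ennreal_add, EReal.neg_add, sub_eq_add_neg, EReal.exp_add]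
  · rfl
  · exact Or.inl (EReal.coe_ennreal_ne_bot x)
  · exact Or.inr (EReal.coe_ennreal_ne_bot y)

lemma expNeg_le_one (x : ℝ≥0∞) : expNeg x ≤ 1 := by
  rw [expNeg, EReal.exp_le_one_iff, EReal.neg_le, neg_zero]
  exact EReal.coe_ennreal_nonneg x

lemma expNeg_antitone : Antitone expNeg := fun x y h => by
  rw [expNeg, expNeg, EReal.exp_le_exp_iff, EReal.neg_le_neg_iff]
  exact EReal.coe_ennreal_le_coe_ennreal_iff.2 h

lemma continuous_expNeg : Continuous expNeg :=
  ENNReal.continuous_exp.comp (continuous_neg.comp continuous_coe_ennreal_ereal)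

@[fun_prop]
lemma measurable_expNeg : Measurable expNeg := continuous_expNeg.measurable

lemma expNeg_ofReal {x : ℝ} (hx : 0 ≤ x) :
    expNeg (ENNReal.ofReal x) = ENNReal.ofReal (Real.exp (-x)) := by
  rw [expNeg, EReal.coe_ennreal_ofReal, max_eq_left hx, ← EReal.coe_neg, EReal.exp_coe]

lemma expNeg_sum {ι : Type*} (s : Finset ι) (f : ι → ℝ≥0∞) :
    expNeg (∑ i ∈ s, f i) = ∏ i ∈ s, expNeg (f i) := by
  classical
  induction s using Finset.induction_on with
  | empty => simp
  | insert i s hi ih => rw [Finset.sum_insert hi, Finset.prod_insert hi, expNeg_add, ih]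

/-- No summability is needed: every series converges in `[0, ∞]`, and `expNeg` is continuous up to
infinity. -/
lemma tendsto_prod_expNeg (f : ℕ → ℝ≥0∞) :
    Tendsto (fun N => ∏ n ∈ Finset.range N, expNeg (f n)) atTop (𝓝 (expNeg (∑' n, f n))) := by
  simp only [← expNeg_sum]
  exact (continuous_expNeg.tendsto _).comp ENNReal.summable.hasSum.tendsto_sum_nat

/-- The inverse of `expNeg`. -/
noncomputable def negLog (y : ℝ≥0∞) : ℝ≥0∞ := (-ENNReal.log y).toENNReal

/-- Puts an averaged factor back into the exponent, so that a marked sum can be treated as an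
unmarked one. -/
lemma expNeg_negLog {y : ℝ≥0∞} (hy : y ≤ 1) : expNeg (negLog y) = y := by
  have h : 0 ≤ -ENNReal.log y := by
    rw [EReal.le_neg, neg_zero]
    exact ENNReal.log_le_zero_iff.2 hy
  rw [expNeg, negLog, EReal.coe_toENNReal h, neg_neg, ENNReal.exp_log]

@[fun_prop]
lemma measurable_negLog : Measurable negLog := by
  unfold negLog
  exact (measurable_ereal_toENNReal).comp (continuous_neg.measurable.comp ENNReal.measurable_log)

/-! ### The Laplace functional of a Poisson process -/

/-- The Poisson generating function at `e^(-c)`: the weights sum to an exponential series in `r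
e^(-c)`. -/
lemma lintegral_expNeg_poissonMeasure (r : ℝ≥0) {c : ℝ≥0∞} (hc : c ≠ ⊤) :
    ∫⁻ k, expNeg (c * (k : ℕ)) ∂(poissonMeasure r) = expNeg (r * (1 - expNeg c)) := by
  lift c to ℝ≥0 using hc
  have hcr : (c : ℝ≥0∞) = ENNReal.ofReal c := by simp
  have hr : (r : ℝ≥0∞) = ENNReal.ofReal r := by simp
  have h1 : Real.exp (-(c : ℝ)) ≤ 1 := Real.exp_le_one_iff.2 (by simp)
  rw [hcr, expNeg_ofReal c.coe_nonneg, hr, ← ENNReal.ofReal_one,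
    ← ENNReal.ofReal_sub _ (Real.exp_nonneg _), ← ENNReal.ofReal_mul r.coe_nonneg,
    expNeg_ofReal (mul_nonneg r.coe_nonneg (by linarith))]
  have h2 : ∀ k : ℕ, expNeg (ENNReal.ofReal c * (k : ℕ)) =
      ENNReal.ofReal (Real.exp (-(c * k))) := by
    intro k
    rw [← ENNReal.ofReal_natCast, ← ENNReal.ofReal_mul c.coe_nonneg, expNeg_ofReal (by positivity)]
  simp only [h2]
  rw [poissonMeasure, lintegral_sum_measure]
  simp only [lintegral_smul_measure, lintegral_dirac, smul_eq_mul]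
  have h3 : ∀ k : ℕ, ENNReal.ofReal (Real.exp (-(r : ℝ)) * r ^ k / k.factorial) *
      ENNReal.ofReal (Real.exp (-(c * k))) =
      ENNReal.ofReal (Real.exp (-(r : ℝ)) * ((r * Real.exp (-(c : ℝ))) ^ k / k.factorial)) := by
    intro k
    rw [← ENNReal.ofReal_mul (by positivity), mul_pow, ← Real.exp_nat_mul]
    congr 1
    rw [show (k : ℝ) * -(c : ℝ) = -(c * k) by ring]
    ring
  simp only [h3]
  have h4 : HasSum (fun k : ℕ =>
      Real.exp (-(r : ℝ)) * ((r * Real.exp (-(c : ℝ))) ^ k / k.factorial))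
      (Real.exp (-(r * (1 - Real.exp (-(c : ℝ)))))) := by
    have := (NormedSpace.expSeries_div_hasSum_exp (r * Real.exp (-(c : ℝ)))).mul_left
      (Real.exp (-(r : ℝ)))
    rw [← Real.exp_eq_exp_ℝ, ← Real.exp_add] at this
    rwa [show -(r : ℝ) + r * Real.exp (-(c : ℝ)) = -(r * (1 - Real.exp (-(c : ℝ)))) by ring] at this
  rw [← h4.tsum_eq, ENNReal.ofReal_tsum_of_nonneg (fun k => by positivity) h4.summable]

lemma tsum_indicator_eq_pointCount {Ω E : Type*} (X : Ω → ℕ → E) (B : Set E) (c : ℝ≥0∞) (ω : Ω) :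
    ∑' n, B.indicator (fun _ => c) (X ω n) = c * (pointCount X B ω : ℝ≥0∞) := by
  have h : ∀ n, B.indicator (fun _ => c) (X ω n) = c * {n | X ω n ∈ B}.indicator 1 n := by
    intro n
    by_cases hn : X ω n ∈ B <;> simp [hn]
  simp only [h]
  rw [ENNReal.tsum_mul_left, ← tsum_subtype]
  simp [pointCount]

namespace IsPoissonProcess

variable {Ω E : Type*} [MeasurableSpace Ω] [MeasurableSpace E]
  {X : Ω → ℕ → E} {μ : Measure E} {P : Measure Ω}

lemma lintegral_expNeg_count (hX : IsPoissonProcess X μ P) {B : Set E} (hB : MeasurableSet B)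
    (hμ : μ B ≠ ⊤) {c : ℝ≥0∞} (hc : c ≠ ⊤) :
    ∫⁻ ω, expNeg (c * (pointCount X B ω : ℝ≥0∞)) ∂P = expNeg (μ B * (1 - expNeg c)) := by
  have h := hX.count_law B hB hμ
  rw [h.lintegral_comp (f := fun k : ℕ∞ => expNeg (c * (k : ℝ≥0∞)))
      Measurable.of_discrete.aemeasurable,
    lintegral_map .of_discrete .of_discrete]
  simp only [ENat.toENNReal_coe]
  rw [lintegral_expNeg_poissonMeasure _ hc, ENNReal.coe_toNNReal hμ]

/-- The sum over points is a combination of the counts of disjoint sets; their independence makes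
the expectation a product. -/
lemma lintegral_expNeg_fin [IsProbabilityMeasure P] (hX : IsPoissonProcess X μ P) {k : ℕ}
    (B : Fin k → Set E)
    (hB : ∀ i, MeasurableSet (B i)) (hμ : ∀ i, μ (B i) ≠ ⊤)
    (hd : Pairwise (fun i j => Disjoint (B i) (B j))) (c : Fin k → ℝ≥0∞) (hc : ∀ i, c i ≠ ⊤) :
    ∫⁻ ω, expNeg (∑' n, ∑ i, (B i).indicator (fun _ => c i) (X ω n)) ∂P =
      expNeg (∑ i, μ (B i) * (1 - expNeg (c i))) := by
  have h1 : ∀ ω, expNeg (∑' n, ∑ i, (B i).indicator (fun _ => c i) (X ω n)) =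
      ∏ i, expNeg (c i * (pointCount X (B i) ω : ℝ≥0∞)) := by
    intro ω
    rw [Summable.tsum_finsetSum (fun i _ => ENNReal.summable), expNeg_sum]
    simp only [tsum_indicator_eq_pointCount]
  simp only [h1]
  have hind := (hX.count_indep k B hB hd).comp
    (fun i (m : ℕ∞) => expNeg (c i * (m : ℝ≥0∞))) (fun i => .of_discrete)
  have := lintegral_prod_eq_prod_lintegral_of_indepFun (μ := P) Finset.univ _ hind ?_
  · simp only [Function.comp_def] at this
    rw [this, expNeg_sum]
    exact Finset.prod_congr rfl fun i _ => hX.lintegral_expNeg_count (hB i) (hμ i) (hc i)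
  · intro i
    simp only [Function.comp_def, ← tsum_indicator_eq_pointCount]
    exact measurable_expNeg.comp (Measurable.tsum fun n => (measurable_const.indicator (hB i)).comp
      ((measurable_pi_apply n).comp hX.measurable))

lemma lintegral_expNeg_simpleFunc [IsProbabilityMeasure P] (hX : IsPoissonProcess X μ P)
    (f : SimpleFunc E ℝ≥0∞) (hf : ∀ x, f x ≠ ⊤) (hfin : ∀ y, y ≠ 0 → μ (f ⁻¹' {y}) ≠ ⊤) :
    ∫⁻ ω, expNeg (∑' n, f (X ω n)) ∂P = expNeg (∫⁻ x, 1 - expNeg (f x) ∂μ) := by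
  classical
  -- The value `0` is dropped: its level set may have infinite intensity, and it contributes nothing
  -- to either side.
  set T := f.range.filter (· ≠ 0)
  have e := T.equivFin
  have hT : ∀ i, (e.symm i : ℝ≥0∞) ≠ 0 ∧ ∃ x, f x = e.symm i := by
    intro i
    have := (e.symm i).2
    simp only [T, Finset.mem_filter, SimpleFunc.mem_range, Set.mem_range] at this
    exact ⟨this.2, this.1⟩
  -- Used with `φ = id` for the sum over points and with `φ = 1 - expNeg` for the intensity
  -- integral; both vanish at `0`.
  have key : ∀ (φ : ℝ≥0∞ → ℝ≥0∞), φ 0 = 0 → ∀ x, φ (f x) =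
      ∑ i, (f ⁻¹' {(e.symm i : ℝ≥0∞)}).indicator (fun _ => φ (e.symm i)) x := by
    intro φ hφ x
    by_cases hx : f x = 0
    · rw [hx, hφ, Finset.sum_eq_zero]
      intro i _
      refine Set.indicator_of_notMem ?_ _
      simp only [Set.mem_preimage, hx, Set.mem_singleton_iff]
      exact (hT i).1.symm
    · have hmem : f x ∈ T := by simp [T, hx]
      rw [Finset.sum_eq_single (e ⟨f x, hmem⟩)]
      · simp
      · intro i _ hi
        refine Set.indicator_of_notMem ?_ _
        simp only [Set.mem_preimage, Set.mem_singleton_iff]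
        intro h
        apply hi
        rw [← e.symm.injective.eq_iff]
        ext
        simp [h]
      · simp
  have h1 := hX.lintegral_expNeg_fin (fun i => f ⁻¹' {(e.symm i : ℝ≥0∞)})
    (fun i => f.measurableSet_fiber _) (fun i => hfin _ (hT i).1)
    (fun i j hij => Set.disjoint_left.2 fun x hx hy => hij
      (e.symm.injective (Subtype.ext (hx.symm.trans hy)))) (fun i => (e.symm i : ℝ≥0∞))
    (fun i => by obtain ⟨x, hx⟩ := (hT i).2; rw [← hx]; exact hf x)
  have h2 := key id rfl
  simp only [id] at h2
  simp only [← h2] at h1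
  rw [h1]
  congr 1
  have h3 := key (fun y => 1 - expNeg y) (by simp)
  simp only [h3]
  rw [lintegral_finsetSum _ (fun i _ => measurable_const.indicator (f.measurableSet_fiber _))]
  refine Finset.sum_congr rfl fun i _ => ?_
  rw [lintegral_indicator_const (f.measurableSet_fiber _), mul_comm]

/-- Monotone approximation by simple functions; both sides pass to the limit because `expNeg` is
continuous on `[0, ∞]`. -/
lemma lintegral_expNeg [IsProbabilityMeasure P] [SigmaFinite μ] (hX : IsPoissonProcess X μ P)
    {f : E → ℝ≥0∞} (hf : Measurable f) :
    ∫⁻ ω, expNeg (∑' n, f (X ω n)) ∂P = expNeg (∫⁻ x, 1 - expNeg (f x) ∂μ) := by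
  have hXn : ∀ n, Measurable (fun ω => X ω n) := fun n => (measurable_pi_apply n).comp hX.measurable
  -- Cutting off outside the spanning sets gives the nonzero level sets finite intensity, and
  -- `eapprox` takes only finite values.
  set g : ℕ → SimpleFunc E ℝ≥0∞ :=
    fun k => (SimpleFunc.eapprox f k).restrict (spanningSets μ k) with hg
  have hga : ∀ k x, g k x = (spanningSets μ k).indicator (SimpleFunc.eapprox f k) x := fun k x => by
    rw [hg, SimpleFunc.restrict_apply _ (measurableSet_spanningSets μ k)]
  have hmono : ∀ x, Monotone fun k => g k x := by
    intro x k l hkl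
    simp only [hga]
    by_cases hx : x ∈ spanningSets μ k
    · rw [Set.indicator_of_mem hx, Set.indicator_of_mem (monotone_spanningSets μ hkl hx)]
      exact SimpleFunc.monotone_eapprox f hkl x
    · rw [Set.indicator_of_notMem hx]
      exact zero_le
  have hlim : ∀ x, Tendsto (fun k => g k x) atTop (𝓝 (f x)) := by
    intro x
    have h1 : Tendsto (fun k => SimpleFunc.eapprox f k x) atTop (𝓝 (f x)) :=
      SimpleFunc.tendsto_eapprox hf x
    refine h1.congr' ?_
    obtain ⟨m, hm⟩ : ∃ m, x ∈ spanningSets μ m :=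
      Set.mem_iUnion.1 ((iUnion_spanningSets μ).symm ▸ Set.mem_univ x)
    filter_upwards [eventually_ge_atTop m] with k hk
    rw [hga, Set.indicator_of_mem (monotone_spanningSets μ hk hm)]
  have hstep : ∀ k, ∫⁻ ω, expNeg (∑' n, g k (X ω n)) ∂P =
      expNeg (∫⁻ x, 1 - expNeg (g k x) ∂μ) := by
    intro k
    refine hX.lintegral_expNeg_simpleFunc (g k) (fun x => ?_) (fun y hy => ?_)
    · rw [hga]
      by_cases hx : x ∈ spanningSets μ k
      · rw [Set.indicator_of_mem hx]
        exact (SimpleFunc.eapprox_lt_top f k x).ne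
      · simp [hx]
    · refine ne_top_of_le_ne_top (measure_spanningSets_lt_top μ k).ne (measure_mono fun x hx => ?_)
      by_contra hx'
      rw [Set.mem_preimage, hga, Set.indicator_of_notMem hx'] at hx
      exact hy hx.symm
  have hL : Tendsto (fun k => ∫⁻ ω, expNeg (∑' n, g k (X ω n)) ∂P) atTop
      (𝓝 (∫⁻ ω, expNeg (∑' n, f (X ω n)) ∂P)) := by
    refine tendsto_lintegral_of_dominated_convergence (fun _ => 1) (fun k => ?_)
      (fun k => .of_forall fun ω => expNeg_le_one _) (by simp) (.of_forall fun ω => ?_)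
    · exact measurable_expNeg.comp
        (Measurable.tsum fun n => (g k).measurable.comp (hXn n))
    · refine (continuous_expNeg.tendsto _).comp ?_
      -- The series is an integral against counting measure, so monotone convergence applies to it.
      have h := lintegral_tendsto_of_tendsto_of_monotone (μ := Measure.count)
        (f := fun k n => g k (X ω n)) (F := fun n => f (X ω n))
        (fun k => Measurable.of_discrete.aemeasurable)
        (.of_forall fun n => hmono _) (.of_forall fun n => hlim _)
      simpa only [lintegral_count] using h
  have hR : Tendsto (fun k => expNeg (∫⁻ x, 1 - expNeg (g k x) ∂μ)) atTop
      (𝓝 (expNeg (∫⁻ x, 1 - expNeg (f x) ∂μ))) := by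
    refine (continuous_expNeg.tendsto _).comp (lintegral_tendsto_of_tendsto_of_monotone
      (fun k => ?_) (.of_forall fun x => ?_) (.of_forall fun x => ?_))
    · exact (measurable_const.sub (measurable_expNeg.comp (g k).measurable)).aemeasurable
    · intro k l hkl
      exact tsub_le_tsub_left (expNeg_antitone (hmono x hkl)) 1
    · exact ENNReal.Tendsto.sub tendsto_const_nhds ((continuous_expNeg.tendsto _).comp (hlim x))
        (Or.inl ENNReal.one_ne_top)
  simp only [hstep] at hL
  exact tendsto_nhds_unique hL hR

end IsPoissonProcess

/-! ### Independent marks -/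

section Marks

variable {Ω E S : Type*} [MeasurableSpace Ω] [MeasurableSpace E] [MeasurableSpace S]
  {P : Measure Ω} {X : Ω → ℕ → E} {m : ℕ → Ω → S} {ν : Measure S}

/-- By Fubini for the joint law of points and marks, the points can be frozen; the factors are then
independent functions of the marks and average separately. -/
lemma lintegral_prod_marks [IsProbabilityMeasure P] (hX : Measurable X)
    (hm : ∀ n, Measurable (m n)) (hlaw : ∀ n, HasLaw (m n) ν P) (hmi : iIndepFun m P)
    (hXm : IndepFun X (fun ω n => m n ω) P) {φ : E → S → ℝ≥0∞}
    (hφ : Measurable (Function.uncurry φ)) (N : ℕ) :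
    ∫⁻ ω, ∏ n ∈ Finset.range N, φ (X ω n) (m n ω) ∂P =
      ∫⁻ ω, ∏ n ∈ Finset.range N, ∫⁻ s, φ (X ω n) s ∂ν ∂P := by
  have hM : Measurable (fun ω n => m n ω) := measurable_pi_lambda _ hm
  have hlawprod := (indepFun_iff_map_prod_eq_prod_map_map hX.aemeasurable hM.aemeasurable).1 hXm
  set F : (ℕ → E) × (ℕ → S) → ℝ≥0∞ := fun z => ∏ n ∈ Finset.range N, φ (z.1 n) (z.2 n) with hF
  have hFm : Measurable F := by
    refine Finset.measurable_prod _ fun n _ => ?_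
    exact hφ.comp (f := fun z : (ℕ → E) × (ℕ → S) => (z.1 n, z.2 n)) (by fun_prop)
  have : IsProbabilityMeasure (P.map X) := Measure.isProbabilityMeasure_map hX.aemeasurable
  have : IsProbabilityMeasure (P.map fun ω n => m n ω) :=
    Measure.isProbabilityMeasure_map hM.aemeasurable
  have h1 : ∫⁻ ω, F (X ω, fun n => m n ω) ∂P =
      ∫⁻ x, ∫⁻ y, F (x, y) ∂(P.map fun ω n => m n ω) ∂(P.map X) := by
    rw [← lintegral_prod _ hFm.aemeasurable, ← hlawprod, lintegral_map hFm (hX.prodMk hM)]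
  change ∫⁻ ω, F (X ω, fun n => m n ω) ∂P = _
  rw [h1, lintegral_map (Measurable.lintegral_prod_right' hFm) hX]
  refine lintegral_congr fun ω => ?_
  rw [lintegral_map (f := fun y => F (X ω, y)) (hFm.comp measurable_prodMk_left) hM]
  have hsec : ∀ n, Measurable (φ (X ω n)) := fun n => hφ.comp measurable_prodMk_left
  have h2 := lintegral_prod_eq_prod_lintegral_of_indepFun (μ := P) (Finset.range N)
    (fun n ω' => φ (X ω n) (m n ω')) (hmi.comp (fun n => φ (X ω n)) hsec)
    (fun n => (hsec n).comp (hm n))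
  rw [hF]
  simp only
  rw [h2]
  exact Finset.prod_congr rfl fun n _ => (hlaw n).lintegral_comp (hsec n).aemeasurable

/-- Averaging over independent identically distributed marks. -/
lemma lintegral_expNeg_marks [IsProbabilityMeasure P] (hX : Measurable X)
    (hm : ∀ n, Measurable (m n)) (hlaw : ∀ n, HasLaw (m n) ν P) (hmi : iIndepFun m P)
    (hXm : IndepFun X (fun ω n => m n ω) P) {q : E → S → ℝ≥0∞}
    (hq : Measurable (Function.uncurry q)) :
    ∫⁻ ω, expNeg (∑' n, q (X ω n) (m n ω)) ∂P =
      ∫⁻ ω, expNeg (∑' n, negLog (∫⁻ s, expNeg (q (X ω n) s) ∂ν)) ∂P := by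
  have hν : IsProbabilityMeasure ν :=
    (hlaw 0).map_eq ▸ Measure.isProbabilityMeasure_map (hm 0).aemeasurable
  have hle : ∀ x, ∫⁻ s, expNeg (q x s) ∂ν ≤ 1 := fun x =>
    (lintegral_mono fun s => expNeg_le_one _).trans (by simp)
  have hXn : ∀ n, Measurable (fun ω => X ω n) := fun n => (measurable_pi_apply n).comp hX
  have hg : Measurable fun x => ∫⁻ s, expNeg (q x s) ∂ν :=
    Measurable.lintegral_prod_right' (f := fun z : E × S => expNeg (q z.1 z.2))
      (measurable_expNeg.comp hq)
  have hprod_le : ∀ (f : ℕ → ℝ≥0∞) (N : ℕ), ∏ n ∈ Finset.range N, expNeg (f n) ≤ 1 :=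
    fun f N => Finset.prod_le_one' fun n _ => expNeg_le_one _
  -- Finite products suffice: the partial products are bounded by `1` and converge to the
  -- exponential of the whole sum.
  have hlim : ∀ (f : ℕ → Ω → ℝ≥0∞), (∀ n, Measurable (f n)) →
      Tendsto (fun N => ∫⁻ ω, ∏ n ∈ Finset.range N, expNeg (f n ω) ∂P) atTop
        (𝓝 (∫⁻ ω, expNeg (∑' n, f n ω) ∂P)) := by
    intro f hf
    refine tendsto_lintegral_of_dominated_convergence (fun _ => 1) (fun N => ?_)
      (fun N => .of_forall fun ω => hprod_le _ _) (by simp)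
      (.of_forall fun ω => tendsto_prod_expNeg _)
    exact Finset.measurable_prod _ fun n _ => measurable_expNeg.comp (hf n)
  have h1 := hlim (fun n ω => q (X ω n) (m n ω)) fun n => hq.comp ((hXn n).prodMk (hm n))
  have h2 := hlim (fun n ω => negLog (∫⁻ s, expNeg (q (X ω n) s) ∂ν))
    fun n => measurable_negLog.comp (hg.comp (hXn n))
  simp only [expNeg_negLog (hle _)] at h2
  refine tendsto_nhds_unique h1 (h2.congr fun N => ?_)
  exact (lintegral_prod_marks hX hm hlaw hmi hXm (φ := fun x s => expNeg (q x s))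
    (measurable_expNeg.comp hq) N).symm

/-- The Laplace functional of an independently marked Poisson process. -/
lemma IsPoissonProcess.lintegral_expNeg_marks [IsProbabilityMeasure P] {μ : Measure E}
    [SigmaFinite μ] (hX : IsPoissonProcess X μ P)
    (hm : ∀ n, Measurable (m n)) (hlaw : ∀ n, HasLaw (m n) ν P) (hmi : iIndepFun m P)
    (hXm : IndepFun X (fun ω n => m n ω) P) {q : E → S → ℝ≥0∞}
    (hq : Measurable (Function.uncurry q)) :
    ∫⁻ ω, expNeg (∑' n, q (X ω n) (m n ω)) ∂P =
      expNeg (∫⁻ x, 1 - ∫⁻ s, expNeg (q x s) ∂ν ∂μ) := by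
  have hν : IsProbabilityMeasure ν :=
    (hlaw 0).map_eq ▸ Measure.isProbabilityMeasure_map (hm 0).aemeasurable
  have hle : ∀ x, ∫⁻ s, expNeg (q x s) ∂ν ≤ 1 := fun x =>
    (lintegral_mono fun s => expNeg_le_one _).trans (by simp)
  have hg : Measurable fun x => ∫⁻ s, expNeg (q x s) ∂ν :=
    Measurable.lintegral_prod_right' (f := fun z : E × S => expNeg (q z.1 z.2))
      (measurable_expNeg.comp hq)
  rw [_root_.lintegral_expNeg_marks hX.measurable hm hlaw hmi hXm hq,
    hX.lintegral_expNeg (f := fun x => negLog (∫⁻ s, expNeg (q x s) ∂ν))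
      (measurable_negLog.comp hg)]
  simp only [expNeg_negLog (hle _)]

/-- The Laplace functional of a Poisson process with two independent sequences of marks. -/
lemma IsPoissonProcess.lintegral_expNeg_marks₂ [IsProbabilityMeasure P] {μ : Measure E}
    [SigmaFinite μ] (hX : IsPoissonProcess X μ P) {S' : Type*} [MeasurableSpace S']
    {m' : ℕ → Ω → S'} {ν' : Measure S'}
    (hm : ∀ n, Measurable (m n)) (hlaw : ∀ n, HasLaw (m n) ν P) (hmi : iIndepFun m P)
    (hXm : IndepFun X (fun ω n => m n ω) P)
    (hm' : ∀ n, Measurable (m' n)) (hlaw' : ∀ n, HasLaw (m' n) ν' P) (hmi' : iIndepFun m' P)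
    (hXm' : IndepFun (fun ω n => (X ω n, m n ω)) (fun ω n => m' n ω) P)
    {q : E → S → S' → ℝ≥0∞} (hq : Measurable fun z : (E × S) × S' => q z.1.1 z.1.2 z.2) :
    ∫⁻ ω, expNeg (∑' n, q (X ω n) (m n ω) (m' n ω)) ∂P =
      expNeg (∫⁻ x, 1 - ∫⁻ s, ∫⁻ s', expNeg (q x s s') ∂ν' ∂ν ∂μ) := by
  have hν' : IsProbabilityMeasure ν' :=
    (hlaw' 0).map_eq ▸ Measure.isProbabilityMeasure_map (hm' 0).aemeasurable
  have hle : ∀ x s, ∫⁻ s', expNeg (q x s s') ∂ν' ≤ 1 := fun x s =>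
    (lintegral_mono fun s' => expNeg_le_one _).trans (by simp)
  have hXn : ∀ n, Measurable (fun ω => X ω n) := fun n => (measurable_pi_apply n).comp hX.measurable
  -- The second marks are averaged first, with the pairs `(X, m)` as the points. That step uses no
  -- Poisson property and leaves a weight depending on `x` and `s` only.
  have h1 := _root_.lintegral_expNeg_marks (X := fun ω n => (X ω n, m n ω))
    (measurable_pi_lambda _ fun n => (hXn n).prodMk (hm n)) hm' hlaw' hmi' hXm'
    (q := fun z s' => q z.1 z.2 s') hq
  have hg : Measurable fun z : E × S => ∫⁻ s', expNeg (q z.1 z.2 s') ∂ν' :=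
    Measurable.lintegral_prod_right' (f := fun z : (E × S) × S' => expNeg (q z.1.1 z.1.2 z.2))
      (measurable_expNeg.comp hq)
  have h2 := hX.lintegral_expNeg_marks hm hlaw hmi hXm
    (q := fun x s => negLog (∫⁻ s', expNeg (q x s s') ∂ν')) (measurable_negLog.comp hg)
  simp only [expNeg_negLog (hle _ _)] at h2
  exact h1.trans h2

end Marks

/-- A random variable is almost surely finite if its Laplace transform tends to `1` at `0`. -/
lemma ae_lt_top_of_tendsto_lintegral_expNeg {Ω : Type*} [MeasurableSpace Ω] {P : Measure Ω}
    [IsProbabilityMeasure P] {Y : Ω → ℝ≥0∞} (hY : Measurable Y) {c : ℕ → ℝ≥0∞}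
    (hc : ∀ k, c k ≠ 0)
    (h : Tendsto (fun k => ∫⁻ ω, expNeg (c k * Y ω) ∂P) atTop (𝓝 1)) : ∀ᵐ ω ∂P, Y ω < ⊤ := by
  have hms : MeasurableSet {ω | Y ω < ⊤} := measurableSet_lt hY measurable_const
  -- Where `Y = ∞` the integrand vanishes, since `c k ≠ 0`; elsewhere it is at most `1`.
  have hle : ∀ k, ∫⁻ ω, expNeg (c k * Y ω) ∂P ≤ P {ω | Y ω < ⊤} := by
    intro k
    rw [← lintegral_indicator_one hms]
    refine lintegral_mono fun ω => ?_
    by_cases hω : Y ω < ⊤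
    · simpa [hω] using expNeg_le_one _
    · have hω' : Y ω = ⊤ := by simpa using hω
      simp [hω', ENNReal.mul_top (hc k)]
  exact (prob_compl_eq_zero_iff hms).2 (le_antisymm prob_le_one (le_of_tendsto' h hle))

/-- Multiplying the rate `1` density by `e^(-ch)` gives `1/(1+c)` times the density of rate `1+c`.
-/
lemma lintegral_expNeg_expMeasure {c : ℝ} (hc : 0 ≤ c) :
    ∫⁻ h, expNeg (ENNReal.ofReal (c * h)) ∂(expMeasure 1) = ENNReal.ofReal (1 / (1 + c)) := by
  have hpdf : expMeasure 1 = volume.withDensity (exponentialPDF 1) := rfl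
  have hm : Measurable (exponentialPDF 1) :=
    (measurable_exponentialPDFReal 1).ennreal_ofReal
  rw [hpdf, lintegral_withDensity_eq_lintegral_mul _ hm (by fun_prop)]
  have key : ∀ h : ℝ, (exponentialPDF 1 * fun h => expNeg (ENNReal.ofReal (c * h))) h =
      ENNReal.ofReal (1 / (1 + c)) * exponentialPDF (1 + c) h := by
    intro h
    rcases lt_or_ge h 0 with hh | hh
    · simp [exponentialPDF_of_neg hh]
    · rw [Pi.mul_apply, exponentialPDF_of_nonneg hh, exponentialPDF_of_nonneg hh,
        expNeg_ofReal (mul_nonneg hc hh), ← ENNReal.ofReal_mul (by positivity),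
        ← ENNReal.ofReal_mul (by positivity), one_mul, ← Real.exp_add,
        ← mul_assoc, one_div_mul_cancel (by positivity), one_mul]
      ring_nf
  simp only [key]
  have hm' : Measurable (exponentialPDF (1 + c)) :=
    (measurable_exponentialPDFReal _).ennreal_ofReal
  rw [lintegral_const_mul _ hm',
    lintegral_exponentialPDF_eq_one (by positivity), mul_one]

/-! ### Euler's integral and the hypergeometric function -/

lemma lintegral_rpow_mul_exp_neg_mul_Ioi {a r : ℝ} (ha : 0 < a) (hr : 0 < r) :
    ∫⁻ t in Ioi (0 : ℝ), ENNReal.ofReal (t ^ (a - 1) * Real.exp (-(r * t))) =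
      ENNReal.ofReal ((1 / r) ^ a * Real.Gamma a) := by
  have h := Real.integral_rpow_mul_exp_neg_mul_Ioi ha hr
  have hpos : 0 < (1 / r) ^ a * Real.Gamma a :=
    mul_pos (by positivity) (Real.Gamma_pos_of_pos ha)
  rw [← h, ofReal_integral_eq_lintegral_ofReal (.of_integral_ne_zero (by rw [h]; exact hpos.ne'))]
  refine (ae_restrict_mem measurableSet_Ioi).mono fun t ht => ?_
  have : (0 : ℝ) < t := ht
  simp only [Pi.zero_apply]
  positivity

/-- Writing `1/(1+u)` as `∫ e^(-(1+u)x) dx` and exchanging the integrals yields `Γ(b) Γ(1-b)`, and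
the reflection formula concludes. Lower integrals spare any integrability check in the exchange. -/
lemma lintegral_rpow_div_one_add_Ioi {b : ℝ} (hb : 0 < b) (hb1 : b < 1) :
    ∫⁻ u in Ioi (0 : ℝ), ENNReal.ofReal (u ^ (b - 1) / (1 + u)) =
      ENNReal.ofReal (Real.pi / Real.sin (Real.pi * b)) := by
  have h1 : ∀ u ∈ Ioi (0 : ℝ), ENNReal.ofReal (u ^ (b - 1) / (1 + u)) =
      ∫⁻ x in Ioi (0 : ℝ), ENNReal.ofReal (u ^ (b - 1) * Real.exp (-((1 + u) * x))) := by
    intro u hu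
    have hu : (0 : ℝ) < u := hu
    have h := lintegral_rpow_mul_exp_neg_mul_Ioi one_pos (show 0 < 1 + u by positivity)
    simp only [sub_self, Real.rpow_zero, one_mul, Real.rpow_one, Real.Gamma_one, mul_one] at h
    simp only [ENNReal.ofReal_mul (Real.rpow_nonneg hu.le (b - 1))]
    rw [lintegral_const_mul _ (by fun_prop), h, ← ENNReal.ofReal_mul (by positivity)]
    congr 1
    ring
  have h2 : ∀ x ∈ Ioi (0 : ℝ),
      ∫⁻ u in Ioi (0 : ℝ), ENNReal.ofReal (u ^ (b - 1) * Real.exp (-((1 + u) * x))) =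
      ENNReal.ofReal (Real.Gamma b) *
        ENNReal.ofReal (x ^ ((1 - b) - 1) * Real.exp (-(1 * x))) := by
    intro x hx
    have hx : (0 : ℝ) < x := hx
    have h3 : ∀ u ∈ Ioi (0 : ℝ), ENNReal.ofReal (u ^ (b - 1) * Real.exp (-((1 + u) * x))) =
        ENNReal.ofReal (Real.exp (-x)) *
          ENNReal.ofReal (u ^ (b - 1) * Real.exp (-(x * u))) := by
      intro u _
      rw [← ENNReal.ofReal_mul (Real.exp_nonneg _),
        show -((1 + u) * x) = -x + -(x * u) by ring, Real.exp_add]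
      congr 1
      ring
    rw [setLIntegral_congr_fun measurableSet_Ioi h3, lintegral_const_mul _ (by fun_prop),
      lintegral_rpow_mul_exp_neg_mul_Ioi hb hx, ← ENNReal.ofReal_mul (Real.exp_nonneg _),
      ← ENNReal.ofReal_mul (Real.Gamma_pos_of_pos hb).le, one_mul,
      show (1 - b) - 1 = -b by ring, Real.rpow_neg hx.le, one_div, Real.inv_rpow hx.le]
    congr 1
    ring
  rw [setLIntegral_congr_fun measurableSet_Ioi h1, lintegral_lintegral_swap (by fun_prop),
    setLIntegral_congr_fun measurableSet_Ioi h2, lintegral_const_mul _ (by fun_prop),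
    lintegral_rpow_mul_exp_neg_mul_Ioi (by linarith) one_pos,
    ← ENNReal.ofReal_mul (Real.Gamma_pos_of_pos hb).le, ← Real.Gamma_mul_Gamma_one_sub]
  simp

lemma integrableOn_rpow_div_one_add_Ioi {b : ℝ} (hb : 0 < b) (hb1 : b < 1) :
    IntegrableOn (fun u : ℝ => u ^ (b - 1) / (1 + u)) (Ioi 0) := by
  refine ⟨Measurable.aestronglyMeasurable (by fun_prop), ?_⟩
  rw [hasFiniteIntegral_iff_ofReal, lintegral_rpow_div_one_add_Ioi hb hb1]
  · exact ENNReal.ofReal_lt_top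
  · refine (ae_restrict_mem measurableSet_Ioi).mono fun u hu => ?_
    have : (0 : ℝ) < u := hu
    simp only [Pi.zero_apply]
    positivity

lemma integral_rpow_div_one_add_Ioi {b : ℝ} (hb : 0 < b) (hb1 : b < 1) :
    ∫ u in Ioi (0 : ℝ), u ^ (b - 1) / (1 + u) = Real.pi / Real.sin (Real.pi * b) := by
  rw [integral_eq_lintegral_of_nonneg_ae _ (integrableOn_rpow_div_one_add_Ioi hb hb1).1,
    lintegral_rpow_div_one_add_Ioi hb hb1, ENNReal.toReal_ofReal]
  · refine div_nonneg Real.pi_pos.le (Real.sin_nonneg_of_nonneg_of_le_pi ?_ ?_)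
    · exact mul_nonneg Real.pi_pos.le hb.le
    · exact mul_le_of_le_one_right Real.pi_pos.le hb1.le
  · refine (ae_restrict_mem measurableSet_Ioi).mono fun u hu => ?_
    have : (0 : ℝ) < u := hu
    simp only [Pi.zero_apply]
    positivity

/-- With `c = b + 1` the factor `(1-t)^(c-b-1)` is trivial and the Gamma quotient equals `b`. -/
lemma gaussHyp_one_eq_integral {b z : ℝ} (hb : 0 < b) :
    gaussHyp 1 b (b + 1) z = b * ∫ t in (0 : ℝ)..1, t ^ (b - 1) / (1 - z * t) := by
  have hg := (Real.Gamma_pos_of_pos hb).ne'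
  simp only [gaussHyp, add_sub_cancel_left, sub_self, Real.rpow_zero, mul_one,
    Real.Gamma_one, Real.rpow_neg_one, Real.Gamma_add_one hb.ne', ← div_eq_mul_inv]
  field_simp

namespace CellParams

variable (p : CellParams)

lemma eta_pos : 0 < p.eta := two_pos.trans p.two_lt_eta

lemma two_div_eta_pos : 0 < 2 / p.eta := div_pos two_pos p.eta_pos

lemma two_div_eta_lt_one : 2 / p.eta < 1 := (div_lt_one p.eta_pos).2 p.two_lt_eta

lemma hyp_neg_eq_integral (c : ℝ) :
    p.hyp (-c) = (1 - 2 / p.eta) * ∫ t in (0 : ℝ)..1, t ^ (-(2 / p.eta)) / (1 + c * t) := by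
  have h := gaussHyp_one_eq_integral (b := 1 - 2 / p.eta) (z := -c)
    (by linarith [p.two_div_eta_lt_one])
  rw [show 1 - 2 / p.eta + 1 = 2 - 2 / p.eta by ring] at h
  rw [hyp, h]
  simp [show 1 - 2 / p.eta - 1 = -(2 / p.eta) by ring]

lemma hyp_neg_nonneg {c : ℝ} (hc : 0 ≤ c) : 0 ≤ p.hyp (-c) := by
  rw [p.hyp_neg_eq_integral]
  refine mul_nonneg (by linarith [p.two_div_eta_lt_one])
    (intervalIntegral.integral_nonneg zero_le_one fun t ht => ?_)
  have := ht.1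
  positivity

lemma intervalIntegrable_rpow_div {a c : ℝ} (ha : 0 ≤ a) (hc : 0 ≤ c) :
    IntervalIntegrable (fun t : ℝ => t ^ (-(2 / p.eta)) / (1 + c * t)) volume 0 a := by
  have h : IntervalIntegrable (fun t : ℝ => t ^ (-(2 / p.eta))) volume 0 a :=
    intervalIntegral.intervalIntegrable_rpow' (by linarith [p.two_div_eta_lt_one])
  refine h.mono_fun (Measurable.aestronglyMeasurable (by fun_prop)) ?_
  rw [uIoc_of_le ha]
  refine (ae_restrict_mem measurableSet_Ioc).mono fun t ht => ?_
  have h0 := ht.1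
  have h1 : 0 ≤ c * t := by positivity
  simp only [norm_div]
  refine div_le_self (norm_nonneg _) ?_
  rw [Real.norm_of_nonneg (by positivity)]
  linarith

/-- The denominator `1 + ct` is dropped. The bound controls the limit at scale `0` in
`ae_summable_ueRx`. -/
lemma hyp_neg_le_one {c : ℝ} (hc : 0 ≤ c) : p.hyp (-c) ≤ 1 := by
  rw [p.hyp_neg_eq_integral]
  have hb : 0 < 1 - 2 / p.eta := by linarith [p.two_div_eta_lt_one]
  have h : ∫ t in (0 : ℝ)..1, t ^ (-(2 / p.eta)) / (1 + c * t) ≤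
      ∫ t in (0 : ℝ)..1, t ^ (-(2 / p.eta)) := by
    refine intervalIntegral.integral_mono_on zero_le_one
      (p.intervalIntegrable_rpow_div zero_le_one hc)
      (intervalIntegral.intervalIntegrable_rpow' (by linarith)) fun t ht => ?_
    have h0 := ht.1
    have h1 : 0 ≤ c * t := by positivity
    exact div_le_self (by positivity) (by linarith)
  rw [integral_rpow (Or.inl (by linarith)), show -(2 / p.eta) + 1 = 1 - 2 / p.eta by ring,
    Real.one_rpow, Real.zero_rpow hb.ne'] at h
  calc _ ≤ (1 - 2 / p.eta) * ((1 - 0) / (1 - 2 / p.eta)) := by gcongr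
    _ = 1 := by field_simp; ring

/-! ### Radial integrals in the plane -/

lemma volume_real_plane_ball : (volume : Measure Plane).real (Metric.ball 0 1) = Real.pi := by
  rw [measureReal_def, EuclideanSpace.volume_ball_fin_two]
  simp [Real.pi_pos.le]

/-- Polar coordinates followed by `y = r^(-η)`, under which `2π r dr` becomes `(2π/η) y^(-2/η-1)
dy`. -/
lemma lintegral_plane_norm_rpow {W : ℝ → ℝ} (hW : ∀ y, 0 ≤ W y)
    (hint : IntegrableOn (fun y => y ^ (-(2 / p.eta) - 1) * W y) (Ioi 0)) :
    ∫⁻ x : Plane, ENNReal.ofReal (W (‖x‖ ^ (-p.eta))) =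
      ENNReal.ofReal (2 * Real.pi / p.eta * ∫ y in Ioi (0 : ℝ), y ^ (-(2 / p.eta) - 1) * W y) := by
  have hη := p.eta_pos
  set g : ℝ → ℝ := fun y => y ^ (-(2 / p.eta) - 1) * W y with hg
  have hrad : ∀ r ∈ Ioi (0 : ℝ), (|(-p.eta)| * r ^ (-p.eta - 1)) • g (r ^ (-p.eta)) =
      p.eta * (r ^ (Module.finrank ℝ Plane - 1) • W (r ^ (-p.eta))) := by
    intro r hr
    have hr : (0 : ℝ) < r := hr
    have h1 : r ^ (-p.eta - 1) * (r ^ (-p.eta)) ^ (-(2 / p.eta) - 1) = r := by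
      rw [← Real.rpow_mul hr.le, ← Real.rpow_add hr]
      conv_rhs => rw [← Real.rpow_one r]
      congr 1
      field_simp
      ring
    simp only [hg, smul_eq_mul, abs_neg, abs_of_pos hη, finrank_euclideanSpace_fin]
    calc p.eta * r ^ (-p.eta - 1) * ((r ^ (-p.eta)) ^ (-(2 / p.eta) - 1) * W (r ^ (-p.eta)))
        = p.eta * ((r ^ (-p.eta - 1) * (r ^ (-p.eta)) ^ (-(2 / p.eta) - 1)) *
            W (r ^ (-p.eta))) := by ring
      _ = _ := by rw [h1]; norm_num
  have hint' : Integrable (fun x : Plane => W (‖x‖ ^ (-p.eta))) := by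
    rw [integrable_fun_norm_addHaar volume (f := fun r => W (r ^ (-p.eta)))]
    have h := (integrableOn_Ioi_comp_rpow_iff g (neg_ne_zero.2 hη.ne')).2 hint
    have h2 := (integrableOn_congr_fun hrad measurableSet_Ioi).1 h
    have h3 := h2.const_mul p.eta⁻¹
    simp only [inv_mul_cancel_left₀ hη.ne'] at h3
    exact h3
  have hval : ∫ x : Plane, W (‖x‖ ^ (-p.eta)) = 2 * Real.pi / p.eta * ∫ y in Ioi (0 : ℝ), g y := by
    rw [integral_fun_norm_addHaar volume (fun r => W (r ^ (-p.eta))), volume_real_plane_ball,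
      ← integral_comp_rpow_Ioi g (neg_ne_zero.2 hη.ne'),
      setIntegral_congr_fun measurableSet_Ioi hrad, integral_const_mul]
    simp only [finrank_euclideanSpace_fin, smul_eq_mul, nsmul_eq_mul]
    push_cast
    field_simp
  rw [← hval, ofReal_integral_eq_lintegral_ofReal hint' (.of_forall fun x => hW _)]

/-- The exterior of the disc corresponds to `0 < y < c` with `c = ro^(-η)`, where the integrand is
`ay/(1+ay)`; rescaling `y = ct` gives Euler's integral. -/
lemma lintegral_plane_outside {ro a : ℝ} (hro : 0 < ro) (ha : 0 ≤ a) :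
    ∫⁻ x : Plane, (1 - if ro < ‖x‖ then ENNReal.ofReal (1 / (1 + a * ‖x‖ ^ (-p.eta))) else 1) =
      ENNReal.ofReal (2 * Real.pi / (p.eta - 2) * ro ^ (2 - p.eta) * a *
        p.hyp (-(ro ^ (-p.eta) * a))) := by
  have hη := p.eta_pos
  have hη2 : 0 < p.eta - 2 := by linarith [p.two_lt_eta]
  set c := ro ^ (-p.eta) with hc
  have hc0 : 0 < c := by positivity
  set W : ℝ → ℝ := (Ioo 0 c).indicator fun y => a * y / (1 + a * y) with hWdef
  have hW : ∀ y, 0 ≤ W y := fun y => indicator_nonneg (fun y hy => by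
    have := hy.1
    positivity) y
  have hint0 : IntervalIntegrable (fun y : ℝ => a * (y ^ (-(2 / p.eta)) / (1 + a * y)))
      volume 0 c :=
    (p.intervalIntegrable_rpow_div hc0.le ha).const_mul a
  have hgW : (fun y => y ^ (-(2 / p.eta) - 1) * W y) =
      (Ioo 0 c).indicator fun y => a * (y ^ (-(2 / p.eta)) / (1 + a * y)) := by
    ext y
    by_cases hy : y ∈ Ioo 0 c
    · simp only [hWdef, indicator_of_mem hy]
      rw [Real.rpow_sub_one hy.1.ne']
      have := hy.1.ne'
      field_simp
    · simp [hWdef, indicator_of_notMem hy]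
  have hsub : Ioo 0 c ∩ Ioi 0 = Ioo 0 c := inter_eq_left.2 fun y hy => hy.1
  have hint : IntegrableOn (fun y => y ^ (-(2 / p.eta) - 1) * W y) (Ioi 0) := by
    rw [hgW]
    refine ((integrable_indicator_iff measurableSet_Ioo).2 ?_).integrableOn
    exact ((intervalIntegrable_iff_integrableOn_Ioo_of_le hc0.le).1 hint0)
  have hval : ∫ y in Ioi (0 : ℝ), y ^ (-(2 / p.eta) - 1) * W y =
      ro ^ (2 - p.eta) * a * ∫ t in (0 : ℝ)..1, t ^ (-(2 / p.eta)) / (1 + c * a * t) := by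
    rw [hgW, setIntegral_indicator measurableSet_Ioo, inter_comm, hsub,
      ← integral_Ioc_eq_integral_Ioo, ← intervalIntegral.integral_of_le hc0.le]
    have h1 := intervalIntegral.mul_integral_comp_mul_left
      (f := fun y : ℝ => a * (y ^ (-(2 / p.eta)) / (1 + a * y))) (a := 0) (b := 1) c
    rw [mul_zero, mul_one] at h1
    rw [← h1, ← intervalIntegral.integral_const_mul, ← intervalIntegral.integral_const_mul]
    refine intervalIntegral.integral_congr fun t ht => ?_
    rw [uIcc_of_le zero_le_one] at ht
    have h2 : c * c ^ (-(2 / p.eta)) = ro ^ (2 - p.eta) := by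
      rw [hc, ← Real.rpow_mul hro.le, ← Real.rpow_add hro]
      congr 1
      field_simp
      ring
    rw [Real.mul_rpow hc0.le ht.1, ← h2]
    ring
  have hcongr : ∀ x : Plane,
      (1 - if ro < ‖x‖ then ENNReal.ofReal (1 / (1 + a * ‖x‖ ^ (-p.eta))) else 1) =
        ENNReal.ofReal (W (‖x‖ ^ (-p.eta))) := by
    intro x
    split_ifs with hx
    · have hx0 : 0 < ‖x‖ := hro.trans hx
      have hmem : ‖x‖ ^ (-p.eta) ∈ Ioo 0 c :=
        ⟨by positivity, Real.rpow_lt_rpow_of_neg hro hx (neg_lt_zero.2 hη)⟩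
      rw [hWdef, indicator_of_mem hmem, ← ENNReal.ofReal_one,
        ← ENNReal.ofReal_sub _ (by positivity)]
      congr 1
      have : 0 < 1 + a * ‖x‖ ^ (-p.eta) := by positivity
      field_simp
      ring
    -- At the origin the convention `0^(-η) = 0` applies; the open interval leaves out `0`, so `W`
    -- vanishes there as well.
    · have hmem : ‖x‖ ^ (-p.eta) ∉ Ioo 0 c := by
        rintro ⟨h0, hlt⟩
        have hx0 : 0 < ‖x‖ := by
          rcases (norm_nonneg x).eq_or_lt with h | h
          · rw [← h, Real.zero_rpow (neg_ne_zero.2 hη.ne')] at h0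
            exact absurd h0 (lt_irrefl _)
          · exact h
        exact not_le.2 hlt
          (Real.rpow_le_rpow_of_nonpos hx0 (not_lt.1 hx) (neg_nonpos.2 hη.le))
      rw [hWdef, indicator_of_notMem hmem]
      simp
  rw [lintegral_congr hcongr, p.lintegral_plane_norm_rpow hW hint, hval, p.hyp_neg_eq_integral]
  congr 1
  field_simp

/-- With nothing excluded, the substitution `u = ay` gives the beta integral with parameter `1 -
2/η`, and `sin(π - 2π/η) = sin(2π/η)`. -/
lemma lintegral_plane_all {a : ℝ} (ha : 0 ≤ a) :
    ∫⁻ x : Plane, (1 - ENNReal.ofReal (1 / (1 + a * ‖x‖ ^ (-p.eta)))) =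
      ENNReal.ofReal (2 * Real.pi ^ 2 / p.eta * a ^ (2 / p.eta) *
        (Real.sin (2 * Real.pi / p.eta))⁻¹) := by
  have hη := p.eta_pos
  -- The rescaling by `a` requires `a > 0`; for `a = 0` both sides vanish.
  rcases ha.eq_or_lt with rfl | ha0
  · simp [Real.zero_rpow p.two_div_eta_pos.ne']
  have hb : 0 < 1 - 2 / p.eta := by linarith [p.two_div_eta_lt_one]
  have hb1 : 1 - 2 / p.eta < 1 := by linarith [p.two_div_eta_pos]
  set W : ℝ → ℝ := (Ioi 0).indicator fun y => a * y / (1 + a * y) with hWdef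
  have hW : ∀ y, 0 ≤ W y := fun y => indicator_nonneg (fun y (hy : 0 < y) => by positivity) y
  set g : ℝ → ℝ := fun u => u ^ (1 - 2 / p.eta - 1) / (1 + u) with hg
  have hgW : ∀ y ∈ Ioi (0 : ℝ), y ^ (-(2 / p.eta) - 1) * W y =
      a ^ (1 + 2 / p.eta) * g (a * y) := by
    intro y hy
    have hy0 : (0 : ℝ) < y := hy
    simp only [hWdef, indicator_of_mem hy, hg]
    rw [show 1 - 2 / p.eta - 1 = -(2 / p.eta) by ring, Real.mul_rpow ha0.le hy0.le,
      Real.rpow_sub_one hy0.ne', Real.rpow_add ha0, Real.rpow_one, Real.rpow_neg ha0.le]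
    have : 0 < a ^ (2 / p.eta) := by positivity
    field_simp
  have hint : IntegrableOn (fun y => y ^ (-(2 / p.eta) - 1) * W y) (Ioi 0) := by
    rw [integrableOn_congr_fun hgW measurableSet_Ioi]
    refine Integrable.const_mul ?_ _
    refine (integrableOn_Ioi_comp_mul_left_iff g 0 ha0).2 ?_
    rw [mul_zero]
    exact integrableOn_rpow_div_one_add_Ioi hb hb1
  have hval : ∫ y in Ioi (0 : ℝ), y ^ (-(2 / p.eta) - 1) * W y =
      a ^ (2 / p.eta) * (Real.pi / Real.sin (2 * Real.pi / p.eta)) := by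
    rw [setIntegral_congr_fun measurableSet_Ioi hgW, integral_const_mul,
      integral_comp_mul_left_Ioi g 0 ha0, mul_zero, integral_rpow_div_one_add_Ioi hb hb1,
      Real.rpow_add ha0, Real.rpow_one, show Real.pi * (1 - 2 / p.eta) =
        Real.pi - 2 * Real.pi / p.eta by ring, Real.sin_pi_sub, smul_eq_mul]
    field_simp
  have hcongr : ∀ x : Plane, (1 - ENNReal.ofReal (1 / (1 + a * ‖x‖ ^ (-p.eta)))) =
        ENNReal.ofReal (W (‖x‖ ^ (-p.eta))) := by
    intro x
    rcases (Real.rpow_nonneg (norm_nonneg x) (-p.eta)).eq_or_lt with h | h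
    · simp [← h, hWdef]
    · rw [hWdef, indicator_of_mem (mem_Ioi.2 h), ← ENNReal.ofReal_one,
        ← ENNReal.ofReal_sub _ (by positivity)]
      congr 1
      have : 0 < 1 + a * ‖x‖ ^ (-p.eta) := by positivity
      field_simp
      ring
  rw [lintegral_congr hcongr, p.lintegral_plane_norm_rpow hW hint, hval]
  congr 1
  ring

end CellParams

/-! ### The distance to the nearest point -/

lemma lintegral_Ioi_rayleigh {k x : ℝ} (hk : 0 < k) (hx : 0 ≤ x) :
    ∫⁻ r in Ioi x, ENNReal.ofReal (2 * k * r * Real.exp (-(k * r ^ 2))) =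
      ENNReal.ofReal (Real.exp (-(k * x ^ 2))) := by
  have hderiv : ∀ r ∈ Ici x, HasDerivAt (fun r => -Real.exp (-(k * r ^ 2)))
      (2 * k * r * Real.exp (-(k * r ^ 2))) r := by
    intro r _
    have h := (((hasDerivAt_pow 2 r).const_mul k).neg.exp).neg
    refine h.congr_deriv ?_
    simp only [Nat.cast_ofNat, Nat.add_one_sub_one, pow_one, Pi.neg_apply]
    ring
  have hpos : ∀ r ∈ Ioi x, 0 ≤ 2 * k * r * Real.exp (-(k * r ^ 2)) := fun r hr => by
    have : 0 < r := hx.trans_lt hr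
    positivity
  have hlim : Tendsto (fun r : ℝ => -Real.exp (-(k * r ^ 2))) atTop (𝓝 0) := by
    rw [← neg_zero]
    refine (Real.tendsto_exp_neg_atTop_nhds_zero.comp ?_).neg
    exact (tendsto_pow_atTop two_ne_zero).const_mul_atTop hk
  rw [← ofReal_integral_eq_lintegral_ofReal
    (integrableOn_Ioi_deriv_of_nonneg' hderiv hpos hlim)
    ((ae_restrict_mem measurableSet_Ioi).mono hpos),
    integral_Ioi_of_hasDerivAt_of_nonneg' hderiv hpos hlim]
  simp

section Nearest

variable {Ω : Type*} [MeasurableSpace Ω] {P : Measure Ω} {X : Ω → ℕ → Plane}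

lemma nearestDist_nonneg {Ω : Type*} (X : Ω → ℕ → Plane) (ω : Ω) : 0 ≤ nearestDist X ω :=
  Real.iInf_nonneg fun _ => norm_nonneg _

lemma measurable_nearestDist (hX : Measurable X) : Measurable (nearestDist X) :=
  Measurable.iInf fun n => ((measurable_pi_apply n).comp hX).norm

lemma nearestDist_lt_iff {Ω : Type*} (X : Ω → ℕ → Plane) (ω : Ω) (r : ℝ) :
    nearestDist X ω < r ↔ pointCount X (Metric.ball 0 r) ω ≠ 0 := by
  have hb : BddBelow (range fun n => ‖X ω n‖) := ⟨0, by rintro _ ⟨n, rfl⟩; exact norm_nonneg _⟩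
  rw [nearestDist, ciInf_lt_iff hb, pointCount, ne_eq, Set.encard_eq_zero, ← ne_eq,
    ← nonempty_iff_ne_empty]
  simp [Set.Nonempty]

namespace IsPoissonProcess

lemma measure_pointCount_eq_zero {E : Type*} [MeasurableSpace E] {Y : Ω → ℕ → E} {μ : Measure E}
    (hY : IsPoissonProcess Y μ P) {B : Set E} (hB : MeasurableSet B) (hμ : μ B ≠ ⊤) :
    P {ω | pointCount Y B ω = 0} = ENNReal.ofReal (Real.exp (-(μ B).toReal)) := by
  have h := hY.count_law B hB hμ
  have h1 : P {ω | pointCount Y B ω = 0} = P.map (pointCount Y B) {0} := by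
    rw [Measure.map_apply_of_aemeasurable h.aemeasurable (measurableSet_singleton _)]
    rfl
  have h2 : (Nat.cast : ℕ → ℕ∞) ⁻¹' {0} = {0} := by
    ext n
    simp
  rw [h1, h.map_eq, Measure.map_apply .of_discrete (measurableSet_singleton _), h2,
    poissonMeasure_singleton]
  simp [ENNReal.toReal]

variable {p : CellParams}

lemma measure_le_nearestDist [IsProbabilityMeasure P] (hX : IsPoissonProcess X p.intensity P)
    {r : ℝ} (hr : 0 ≤ r) :
    P {ω | r ≤ nearestDist X ω} = ENNReal.ofReal (Real.exp (-(Real.pi * p.lam * r ^ 2))) := by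
  have hμ : p.intensity (Metric.ball 0 r) = ENNReal.ofReal (Real.pi * p.lam * r ^ 2) := by
    rw [CellParams.intensity, Measure.smul_apply, EuclideanSpace.volume_ball_fin_two, smul_eq_mul,
      ← ENNReal.ofReal_pow hr, ← ENNReal.ofReal_mul (by positivity),
      ← ENNReal.ofReal_mul p.lam_pos.le]
    congr 1
    ring
  have h := hX.measure_pointCount_eq_zero (B := Metric.ball 0 r) measurableSet_ball
    (by rw [hμ]; exact ENNReal.ofReal_ne_top)
  have hpos := p.lam_pos
  rw [hμ, ENNReal.toReal_ofReal (by positivity)] at h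
  rw [← h]
  congr 1
  ext ω
  have := nearestDist_lt_iff X ω r
  rw [← not_iff_not]
  simpa using this

/-- The void probability of the disc of radius `x` is the tail of the nearest distance, and tails
over `[x, ∞)` determine a law. For `x < 0` both tails are those at `0`. -/
lemma map_nearestDist [IsProbabilityMeasure P] (hX : IsPoissonProcess X p.intensity P) :
    P.map (nearestDist X) = ((volume : Measure ℝ).restrict (Ioi 0)).withDensity
      (fun r => ENNReal.ofReal
        (2 * (Real.pi * p.lam) * r * Real.exp (-(Real.pi * p.lam * r ^ 2)))) := by
  have hk : 0 < Real.pi * p.lam := mul_pos Real.pi_pos p.lam_pos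
  have hm := measurable_nearestDist hX.measurable
  have : IsProbabilityMeasure (P.map (nearestDist X)) :=
    Measure.isProbabilityMeasure_map hm.aemeasurable
  have hnonneg : ∀ x : ℝ, 0 ≤ x → P.map (nearestDist X) (Ici x) =
      ((volume : Measure ℝ).restrict (Ioi 0)).withDensity (fun r => ENNReal.ofReal
        (2 * (Real.pi * p.lam) * r * Real.exp (-(Real.pi * p.lam * r ^ 2)))) (Ici x) := by
    intro x hx
    rw [Measure.map_apply hm measurableSet_Ici, withDensity_apply _ measurableSet_Ici,
      Measure.restrict_restrict measurableSet_Ici]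
    refine (hX.measure_le_nearestDist hx).trans ((lintegral_Ioi_rayleigh hk hx).symm.trans ?_)
    rcases hx.eq_or_lt with rfl | hx0
    · rw [inter_eq_right.2 Ioi_subset_Ici_self]
    · rw [inter_eq_left.2 (Ici_subset_Ioi.2 hx0), setLIntegral_congr Ioi_ae_eq_Ici]
  refine Measure.ext_of_Ici _ _ fun x => ?_
  rcases le_or_gt 0 x with hx | hx
  · exact hnonneg x hx
  · have h1 : P.map (nearestDist X) (Ici x) = P.map (nearestDist X) (Ici 0) := by
      rw [Measure.map_apply hm measurableSet_Ici, Measure.map_apply hm measurableSet_Ici]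
      congr 1
      ext ω
      have := nearestDist_nonneg X ω
      simp only [mem_preimage, mem_Ici, this, iff_true]
      exact hx.le.trans this
    rw [h1, hnonneg 0 le_rfl, withDensity_apply _ measurableSet_Ici,
      withDensity_apply _ measurableSet_Ici, Measure.restrict_restrict measurableSet_Ici,
      Measure.restrict_restrict measurableSet_Ici, inter_eq_right.2 Ioi_subset_Ici_self,
      inter_eq_right.2 (Ioi_subset_Ici_self.trans (Ici_subset_Ici.2 hx.le))]

end IsPoissonProcess

end Nearest

/-! ### The law of the link distance -/

namespace CellParams

variable (p : CellParams)

lemma rMax_pos : 0 < p.rMax := Real.rpow_pos_of_pos (div_pos p.pMax_pos p.rho_pos) _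

lemma invPower_le_iff {r : ℝ} (hr : 0 ≤ r) : p.invPower r ≤ p.pMax ↔ r ≤ p.rMax := by
  rw [invPower, rMax, mul_comm, ← le_div_iff₀ p.rho_pos, one_div,
    Real.le_rpow_inv_iff_of_pos hr (div_pos p.pMax_pos p.rho_pos).le p.eta_pos]

@[fun_prop]
lemma measurable_invPower : Measurable p.invPower := by
  unfold invPower
  fun_prop

lemma one_sub_exp_pos : 0 < 1 - Real.exp (-(Real.pi * p.lam * p.rMax ^ 2)) := by
  have := mul_pos (mul_pos Real.pi_pos p.lam_pos) (pow_pos p.rMax_pos 2)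
  simpa using this

lemma distDensity_nonneg {r : ℝ} (hr : 0 ≤ r) : 0 ≤ p.distDensity r := by
  have := p.one_sub_exp_pos
  have := p.lam_pos
  unfold distDensity
  positivity

@[fun_prop]
lemma continuous_distDensity : Continuous p.distDensity := by
  unfold distDensity
  fun_prop

end CellParams

section LinkDist

variable {p : CellParams} {Ω : Type*} [MeasurableSpace Ω] {P : Measure Ω} {X : Ω → ℕ → Plane}

lemma linkDistLaw_eq [IsProbabilityMeasure P] (hX : IsPoissonProcess X p.intensity P) :
    linkDistLaw p P X = ((volume : Measure ℝ).restrict (Set.Ioc 0 p.rMax)).withDensity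
      (fun r => ENNReal.ofReal (p.distDensity r)) := by
  have hm := measurable_nearestDist hX.measurable
  have hk : 0 < Real.pi * p.lam := mul_pos Real.pi_pos p.lam_pos
  set S : Set ℝ := {r | p.invPower r ≤ p.pMax} with hS
  have hSm : MeasurableSet S := measurableSet_le p.measurable_invPower measurable_const
  set d : ℝ → ℝ≥0∞ := fun r => ENNReal.ofReal
    (2 * (Real.pi * p.lam) * r * Real.exp (-(Real.pi * p.lam * r ^ 2))) with hd
  have hdm : Measurable d := by fun_prop
  -- Real powers of negative numbers carry conventional values, so `S` is identified only inside
  -- `(0, ∞)`, where the law is concentrated.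
  have hinter : S ∩ Ioi 0 = Ioc 0 p.rMax := by
    ext r
    simp only [hS, mem_inter_iff, mem_ofPred_eq, mem_Ioi, mem_Ioc]
    constructor
    · rintro ⟨h1, h2⟩
      exact ⟨h2, (p.invPower_le_iff h2.le).1 h1⟩
    · rintro ⟨h1, h2⟩
      exact ⟨(p.invPower_le_iff h1.le).2 h2, h1⟩
  have hPS : P (nearestDist X ⁻¹' S) =
      ENNReal.ofReal (1 - Real.exp (-(Real.pi * p.lam * p.rMax ^ 2))) := by
    rw [← Measure.map_apply hm hSm, hX.map_nearestDist, withDensity_apply _ hSm,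
      Measure.restrict_restrict hSm, hinter]
    -- The mass of `(0, R_M]` is the total mass `1` minus the tail beyond `R_M`.
    have hfin : ∫⁻ r in Ioi p.rMax, d r ≠ ⊤ := by
      rw [hd, lintegral_Ioi_rayleigh hk p.rMax_pos.le]
      exact ENNReal.ofReal_ne_top
    have hunion := lintegral_union (μ := volume) (f := d) measurableSet_Ioi
      (Ioc_disjoint_Ioi_same (a := 0) (b := p.rMax))
    rw [Ioc_union_Ioi_eq_Ioi p.rMax_pos.le] at hunion
    have h0 : ∫⁻ r in Ioi (0 : ℝ), d r = 1 := by
      rw [hd, lintegral_Ioi_rayleigh hk le_rfl]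
      simp
    rw [h0] at hunion
    rw [← ENNReal.sub_eq_of_eq_add hfin hunion, hd, lintegral_Ioi_rayleigh hk p.rMax_pos.le,
      ENNReal.ofReal_sub _ (Real.exp_nonneg _), ENNReal.ofReal_one]
  have hcond : linkDistLaw p P X =
      (P (nearestDist X ⁻¹' S))⁻¹ • (P.map (nearestDist X)).restrict S := by
    rw [linkDistLaw, ProbabilityTheory.cond, Measure.map_smul, Measure.restrict_map hm hSm]
    rfl
  rw [hcond, hPS, hX.map_nearestDist, restrict_withDensity hSm, Measure.restrict_restrict hSm,
    hinter, ← withDensity_smul _ hdm]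
  refine withDensity_congr_ae (.of_forall fun r => ?_)
  simp only [Pi.smul_apply, smul_eq_mul, hd]
  rw [← ENNReal.ofReal_inv_of_pos p.one_sub_exp_pos,
    ← ENNReal.ofReal_mul (inv_nonneg.2 p.one_sub_exp_pos.le), CellParams.distDensity]
  congr 1
  rw [div_eq_inv_mul]
  ring

lemma integral_linkDistLaw [IsProbabilityMeasure P] (hX : IsPoissonProcess X p.intensity P)
    (f : ℝ → ℝ) :
    ∫ r, f r ∂(linkDistLaw p P X) = ∫ r in (0 : ℝ)..p.rMax, p.distDensity r * f r := by
  rw [linkDistLaw_eq hX, integral_withDensity_eq_integral_toReal_smul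
    (by fun_prop) (.of_forall fun r => ENNReal.ofReal_lt_top),
    intervalIntegral.integral_of_le p.rMax_pos.le]
  refine setIntegral_congr_fun measurableSet_Ioc fun r hr => ?_
  simp only [smul_eq_mul]
  rw [ENNReal.toReal_ofReal (p.distDensity_nonneg hr.1.le)]

lemma ae_linkDistLaw [IsProbabilityMeasure P] (hX : IsPoissonProcess X p.intensity P) :
    ∀ᵐ r ∂(linkDistLaw p P X), r ∈ Ioc 0 p.rMax := by
  rw [linkDistLaw_eq hX]
  exact (withDensity_absolutelyContinuous _ _).ae_le (ae_restrict_mem measurableSet_Ioc)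

/-- The substitution `t = πλr²` turns the second moment into `γ(2, πλR_M²)`; the factor `ρ^(2/η)` is
there because `P_u^(2/η) = ρ^(2/η) R²`. -/
lemma integral_sq_linkDistLaw [IsProbabilityMeasure P] (hX : IsPoissonProcess X p.intensity P) :
    p.rho ^ (2 / p.eta) * ∫ r, r ^ 2 ∂(linkDistLaw p P X) = p.powerMoment := by
  have hk : 0 < Real.pi * p.lam := mul_pos Real.pi_pos p.lam_pos
  have h1 := intervalIntegral.integral_comp_mul_deriv (a := 0) (b := p.rMax)
    (f := fun r => Real.pi * p.lam * r ^ 2) (f' := fun r => 2 * (Real.pi * p.lam) * r)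
    (g := fun t => t * Real.exp (-t)) (fun r _ => by
      refine ((hasDerivAt_pow 2 r).const_mul (Real.pi * p.lam)).congr_deriv ?_
      simp only [Nat.cast_ofNat, Nat.add_one_sub_one, pow_one]
      ring) (by fun_prop) (by fun_prop)
  have h2 : lowerGamma 2 (Real.pi * p.lam * p.rMax ^ 2) =
      ∫ t in (0 : ℝ)..Real.pi * p.lam * p.rMax ^ 2, t * Real.exp (-t) := by
    unfold lowerGamma
    norm_num
  simp only [ne_eq, OfNat.ofNat_ne_zero, not_false_eq_true, zero_pow, mul_zero] at h1
  rw [integral_linkDistLaw hX, CellParams.powerMoment, h2, ← h1, mul_div_assoc]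
  congr 1
  rw [eq_div_iff (mul_pos hk p.one_sub_exp_pos).ne', ← intervalIntegral.integral_mul_const]
  refine intervalIntegral.integral_congr fun r _ => ?_
  have := p.one_sub_exp_pos.ne'
  simp only [CellParams.distDensity, Function.comp]
  field_simp

lemma lintegral_sq_linkDistLaw [IsProbabilityMeasure P] (hX : IsPoissonProcess X p.intensity P)
    [IsProbabilityMeasure (linkDistLaw p P X)] {K : ℝ} (hK : 0 ≤ K) :
    ∫⁻ r, ENNReal.ofReal (K * r ^ 2) ∂(linkDistLaw p P X) =
      ENNReal.ofReal (K * (p.powerMoment / p.rho ^ (2 / p.eta))) := by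
  have hint : Integrable (fun r : ℝ => K * r ^ 2) (linkDistLaw p P X) := by
    refine Integrable.const_mul (.of_bound (by fun_prop) (p.rMax ^ 2) ?_) K
    filter_upwards [ae_linkDistLaw hX] with r hr
    rw [Real.norm_of_nonneg (sq_nonneg r)]
    have := hr.1.le
    have := hr.2
    gcongr
  have hρ := Real.rpow_pos_of_pos p.rho_pos (2 / p.eta)
  rw [← integral_sq_linkDistLaw hX, mul_div_cancel_left₀ _ hρ.ne', ← integral_const_mul,
    ofReal_integral_eq_lintegral_ofReal hint (.of_forall fun r => by positivity)]

end LinkDist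

namespace CellNetwork

variable {p : CellParams} {Ω : Type*} [MeasurableSpace Ω] {P : Measure Ω} (N : CellNetwork p P)

/-! ### Independence -/

/-- A version of `measurable_pi_lambda` in which the σ-algebra on the domain is inferred by
unification. -/
lemma measurable_sequence {Ω α : Type*} {m : MeasurableSpace Ω} [MeasurableSpace α] {f : Ω → ℕ → α}
    (h : ∀ n, Measurable[m] fun ω => f ω n) : Measurable[m] f :=
  measurable_pi_lambda _ h

/-- The σ-algebra generated by a source of randomness. -/
@[reducible]
def source : RandomSource → MeasurableSpace Ω
  | .bsLoc => MeasurableSpace.comap N.bsLoc inferInstance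
  | .ueLoc => MeasurableSpace.comap N.ueLoc inferInstance
  | .bsFade n => MeasurableSpace.comap (N.bsFade n) inferInstance
  | .ueFade n => MeasurableSpace.comap (N.ueFade n) inferInstance
  | .ueDist n => MeasurableSpace.comap (N.ueDist n) inferInstance
  | .cellDist => MeasurableSpace.comap N.cellDist inferInstance
  | .cellAngle => MeasurableSpace.comap N.cellAngle inferInstance
  | .cellFade => MeasurableSpace.comap N.cellFade inferInstance
  | .siGain => MeasurableSpace.comap N.siGain inferInstance

lemma iIndep_source : iIndep N.source P := by
  have h := N.indep
  -- The two `match` expressions unfold to the same σ-algebra only once the constructor is known.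
  refine (congrArg (fun m => iIndep m P) (funext fun i => ?_)).mp h
  cases i <;> rfl

lemma source_le (i : RandomSource) : N.source i ≤ ‹MeasurableSpace Ω› := by
  cases i with
  | bsLoc => exact N.bsLoc_poisson.measurable.comap_le
  | ueLoc => exact N.ueLoc_poisson.measurable.comap_le
  | bsFade n => exact (N.bsFade_measurable n).comap_le
  | ueFade n => exact (N.ueFade_measurable n).comap_le
  | ueDist n => exact (N.ueDist_measurable n).comap_le
  | cellDist => exact N.cellDist_measurable.comap_le
  | cellAngle => exact N.cellAngle_measurable.comap_le
  | cellFade => exact N.cellFade_measurable.comap_le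
  | siGain => exact N.siGain_measurable.comap_le

/-- The common source of the pairwise independence facts below: quantities built from disjoint sets
of sources are independent. -/
lemma indepFun_of_disjoint {α β : Type*} [MeasurableSpace α] [MeasurableSpace β] {f : Ω → α}
    {g : Ω → β} (S T : Set RandomSource) (hST : Disjoint S T)
    (hf : Measurable[⨆ i ∈ S, N.source i] f) (hg : Measurable[⨆ i ∈ T, N.source i] g) :
    IndepFun f g P := by
  rw [IndepFun_iff_Indep]
  exact indep_of_indep_of_le_left (indep_of_indep_of_le_right
    (indep_iSup_of_disjoint N.source_le N.iIndep_source hST) hg.comap_le) hf.comap_le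

lemma measurable_iSup_source {α : Type*} [mα : MeasurableSpace α] {f : Ω → α}
    {S : Set RandomSource} {i : RandomSource} (hi : i ∈ S)
    (hf : N.source i = MeasurableSpace.comap f mα) : Measurable[⨆ i ∈ S, N.source i] f := by
  rw [measurable_iff_comap_le, ← hf]
  exact le_iSup₂ (f := fun j (_ : j ∈ S) => N.source j) i hi

lemma iIndepFun_bsFade : iIndepFun N.bsFade P :=
  N.iIndep_source.precomp (g := RandomSource.bsFade) fun _ _ h => RandomSource.bsFade.inj h

lemma iIndepFun_ueFade : iIndepFun N.ueFade P :=
  N.iIndep_source.precomp (g := RandomSource.ueFade) fun _ _ h => RandomSource.ueFade.inj h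

lemma iIndepFun_ueDist : iIndepFun N.ueDist P :=
  N.iIndep_source.precomp (g := RandomSource.ueDist) fun _ _ h => RandomSource.ueDist.inj h

/-- The randomness of the interfering base stations. -/
def bsData (ω : Ω) : (ℕ → Plane) × (ℕ → ℝ) := (N.bsLoc ω, fun n => N.bsFade n ω)

/-- The randomness of the interfering users. -/
def ueData (ω : Ω) : (ℕ → Plane × ℝ) × (ℕ → ℝ) :=
  (fun n => (N.ueLoc ω n, N.ueDist n ω), fun n => N.ueFade n ω)

/-- The randomness of the test cell. -/
def cellData (ω : Ω) : (ℝ × ℝ) × (ℝ × ℝ) :=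
  ((N.cellDist ω, N.cellAngle ω), (N.cellFade ω, N.siGain ω))

/-- The sources of randomness of the interfering base stations. -/
def bsSources : Set RandomSource := {i | i = .bsLoc ∨ ∃ n, i = .bsFade n}

/-- The sources of randomness of the interfering users. -/
def ueSources : Set RandomSource := {i | i = .ueLoc ∨ (∃ n, i = .ueFade n) ∨ ∃ n, i = .ueDist n}

lemma measurable_bsData : Measurable N.bsData :=
  N.bsLoc_poisson.measurable.prodMk (measurable_pi_lambda _ N.bsFade_measurable)

lemma measurable_ueData : Measurable N.ueData :=
  (measurable_pi_lambda _ fun n => ((measurable_pi_apply n).comp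
    N.ueLoc_poisson.measurable).prodMk (N.ueDist_measurable n)).prodMk
    (measurable_pi_lambda _ N.ueFade_measurable)

lemma measurable_cellData : Measurable N.cellData :=
  (N.cellDist_measurable.prodMk N.cellAngle_measurable).prodMk
    (N.cellFade_measurable.prodMk N.siGain_measurable)

lemma measurable_ueLocDist {S : Set RandomSource} (h1 : .ueLoc ∈ S) (h2 : ∀ n, .ueDist n ∈ S) :
    Measurable[⨆ i ∈ S, N.source i] fun ω n => (N.ueLoc ω n, N.ueDist n ω) :=
  measurable_sequence fun n => ((measurable_pi_apply n).comp
    (N.measurable_iSup_source h1 rfl)).prodMk (N.measurable_iSup_source (h2 n) rfl)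

lemma measurable_cellData_iSup {S : Set RandomSource} (h1 : .cellDist ∈ S) (h2 : .cellAngle ∈ S)
    (h3 : .cellFade ∈ S) (h4 : .siGain ∈ S) : Measurable[⨆ i ∈ S, N.source i] N.cellData :=
  ((N.measurable_iSup_source h1 rfl).prodMk (N.measurable_iSup_source h2 rfl)).prodMk
    ((N.measurable_iSup_source h3 rfl).prodMk (N.measurable_iSup_source h4 rfl))

lemma measurable_ueData_iSup {S : Set RandomSource} (h1 : .ueLoc ∈ S) (h2 : ∀ n, .ueDist n ∈ S)
    (h3 : ∀ n, .ueFade n ∈ S) : Measurable[⨆ i ∈ S, N.source i] N.ueData :=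
  (N.measurable_ueLocDist h1 h2).prodMk
    (measurable_sequence fun n => N.measurable_iSup_source (h3 n) rfl)

lemma indepFun_bsData : IndepFun N.bsData (fun ω => (N.ueData ω, N.cellData ω)) P := by
  refine N.indepFun_of_disjoint bsSources bsSourcesᶜ disjoint_compl_right ?_ ?_
  · exact (N.measurable_iSup_source (i := .bsLoc) (by simp [bsSources]) rfl).prodMk
      (measurable_sequence fun n => N.measurable_iSup_source (i := .bsFade n)
        (by simp [bsSources]) rfl)
  · exact (N.measurable_ueData_iSup (by simp [bsSources]) (by simp [bsSources])
      (by simp [bsSources])).prodMk (N.measurable_cellData_iSup (by simp [bsSources])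
      (by simp [bsSources]) (by simp [bsSources]) (by simp [bsSources]))

lemma indepFun_ueData : IndepFun N.ueData N.cellData P :=
  N.indepFun_of_disjoint ueSources ueSourcesᶜ disjoint_compl_right
    (N.measurable_ueData_iSup (by simp [ueSources]) (by simp [ueSources]) (by simp [ueSources]))
    (N.measurable_cellData_iSup (by simp [ueSources])
      (by simp [ueSources]) (by simp [ueSources]) (by simp [ueSources]))

lemma indepFun_bsLoc_bsFade : IndepFun N.bsLoc (fun ω n => N.bsFade n ω) P :=
  N.indepFun_of_disjoint {.bsLoc} {.bsLoc}ᶜ disjoint_compl_right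
    (N.measurable_iSup_source rfl rfl)
    (measurable_sequence fun n => N.measurable_iSup_source (i := .bsFade n) (by simp) rfl)

lemma indepFun_ueLoc_ueDist : IndepFun N.ueLoc (fun ω n => N.ueDist n ω) P :=
  N.indepFun_of_disjoint {.ueLoc} {.ueLoc}ᶜ disjoint_compl_right
    (N.measurable_iSup_source rfl rfl)
    (measurable_sequence fun n => N.measurable_iSup_source (i := .ueDist n) (by simp) rfl)

lemma indepFun_ueLocDist_ueFade :
    IndepFun (fun ω n => (N.ueLoc ω n, N.ueDist n ω)) (fun ω n => N.ueFade n ω) P :=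
  N.indepFun_of_disjoint {i | ∃ n, i = .ueFade n}ᶜ {i | ∃ n, i = .ueFade n} disjoint_compl_left
    (N.measurable_ueLocDist (by simp) (by simp))
    (measurable_sequence fun n => N.measurable_iSup_source (i := .ueFade n) (by simp) rfl)

lemma indepFun_cellDist_cellAngle : IndepFun N.cellDist N.cellAngle P :=
  N.indepFun_of_disjoint {.cellDist} {.cellAngle} (by simp)
    (N.measurable_iSup_source rfl rfl) (N.measurable_iSup_source rfl rfl)

lemma indepFun_cellFade :
    IndepFun (fun ω => (N.cellDist ω, N.cellAngle ω)) N.cellFade P :=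
  N.indepFun_of_disjoint {.cellFade}ᶜ {.cellFade} disjoint_compl_left
    ((N.measurable_iSup_source (i := .cellDist) (by simp) rfl).prodMk
      (N.measurable_iSup_source (i := .cellAngle) (by simp) rfl))
    (N.measurable_iSup_source rfl rfl)

/-! ### Signs -/

/-- `ENNReal.ofReal` truncates negative values, so real sums and `[0, ∞]`-valued sums agree only
once signs are known almost surely. -/
lemma ae_nonneg_expMeasure : ∀ᵐ h ∂(expMeasure 1), 0 ≤ h := by
  have hpdf : expMeasure 1 = volume.withDensity (exponentialPDF 1) := rfl
  have hm : Measurable (exponentialPDF 1) := (measurable_exponentialPDFReal 1).ennreal_ofReal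
  rw [hpdf, ae_withDensity_iff hm]
  refine .of_forall fun h hh => ?_
  by_contra hneg
  exact hh (exponentialPDF_of_neg (not_le.1 hneg))

lemma ae_bsFade_nonneg : ∀ᵐ ω ∂P, ∀ n, 0 ≤ N.bsFade n ω :=
  ae_all_iff.2 fun n => ((N.bsFade_law n).ae_iff (by measurability)).2 ae_nonneg_expMeasure

lemma ae_ueFade_nonneg : ∀ᵐ ω ∂P, ∀ n, 0 ≤ N.ueFade n ω :=
  ae_all_iff.2 fun n => ((N.ueFade_law n).ae_iff (by measurability)).2 ae_nonneg_expMeasure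

lemma ae_ueDist_mem [IsProbabilityMeasure P] : ∀ᵐ ω ∂P, ∀ n, N.ueDist n ω ∈ Ioc 0 p.rMax :=
  ae_all_iff.2 fun n => ((N.ueDist_law n).ae_iff (by measurability)).2
    (ae_linkDistLaw N.bsLoc_poisson)

end CellNetwork

/-- Moves `1 - ·` inside the average over user distances, which prepares the exchange with the plane
integral. -/
lemma one_sub_lintegral {S : Type*} [MeasurableSpace S] {ν : Measure S} [IsProbabilityMeasure ν]
    {g : S → ℝ≥0∞} (hg : Measurable g) (h1 : ∀ s, g s ≤ 1) :
    1 - ∫⁻ s, g s ∂ν = ∫⁻ s, (1 - g s) ∂ν := by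
  rw [lintegral_sub hg (ne_top_of_le_ne_top ENNReal.one_ne_top
    ((lintegral_mono h1).trans (by simp))) (.of_forall h1)]
  simp

namespace CellNetwork

variable {p : CellParams} {Ω : Type*} [MeasurableSpace Ω] {P : Measure Ω} (N : CellNetwork p P)

instance : SigmaFinite p.intensity := by
  have h : p.intensity = p.lam.toNNReal • (volume : Measure Plane) := rfl
  rw [h]
  infer_instance

lemma isProbabilityMeasure_linkDistLaw [IsProbabilityMeasure P] :
    IsProbabilityMeasure (linkDistLaw p P N.bsLoc) :=
  (N.ueDist_law 0).map_eq ▸ Measure.isProbabilityMeasure_map (N.ueDist_measurable 0).aemeasurable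

/-! ### Interference from the base stations -/

/-- The radius `-1` excludes no point, not even the origin, so the uplink becomes an instance of the
statements with an excluded disc. -/
lemma bsRxOutside_neg_one (n : ℕ) (ω : Ω) : N.bsRxOutside (-1) n ω = N.bsRx n ω :=
  if_pos (by linarith [norm_nonneg (N.bsLoc ω n)])

open Classical in
/-- The received power, scaled by `a`, from a base station at `x` with channel gain `h`. -/
noncomputable def bsPower (p : CellParams) (a ro : ℝ) (x : Plane) (h : ℝ) : ℝ≥0∞ :=
  ENNReal.ofReal (a * if ro < ‖x‖ then p.pDl * h * ‖x‖ ^ (-p.eta) else 0)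

lemma measurable_bsPower (a ro : ℝ) : Measurable (Function.uncurry (bsPower p a ro)) := by
  unfold bsPower Function.uncurry
  refine ENNReal.measurable_ofReal.comp (measurable_const.mul (Measurable.ite ?_ ?_ ?_))
  · exact measurableSet_lt measurable_const (by fun_prop)
  · fun_prop
  · fun_prop

lemma ofReal_bsRxOutside (a ro : ℝ) (n : ℕ) (ω : Ω) :
    ENNReal.ofReal (a * N.bsRxOutside ro n ω) = bsPower p a ro (N.bsLoc ω n) (N.bsFade n ω) := by
  rfl

lemma lintegral_expNeg_bs [IsProbabilityMeasure P] {a : ℝ} (ha : 0 ≤ a) (ro : ℝ) :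
    ∫⁻ ω, expNeg (∑' n, ENNReal.ofReal (a * N.bsRxOutside ro n ω)) ∂P =
      expNeg (ENNReal.ofReal p.lam * ∫⁻ x : Plane, (1 - if ro < ‖x‖ then
        ENNReal.ofReal (1 / (1 + a * p.pDl * ‖x‖ ^ (-p.eta))) else 1)) := by
  simp only [ofReal_bsRxOutside]
  rw [N.bsLoc_poisson.lintegral_expNeg_marks N.bsFade_measurable N.bsFade_law N.iIndepFun_bsFade
    N.indepFun_bsLoc_bsFade (measurable_bsPower a ro), CellParams.intensity,
    lintegral_smul_measure, smul_eq_mul]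
  congr 3
  ext x
  congr 1
  split_ifs with hx
  · have hpow := Real.rpow_nonneg (norm_nonneg x) (-p.eta)
    rw [← lintegral_expNeg_expMeasure
      (mul_nonneg (mul_nonneg ha p.pDl_pos.le) hpow)]
    refine lintegral_congr fun h => ?_
    rw [bsPower, if_pos hx]
    congr 2
    ring
  · have := isProbabilityMeasure_expMeasure one_pos
    simp [bsPower, hx]

lemma lintegral_expNeg_bsOutside [IsProbabilityMeasure P] {a ro : ℝ} (ha : 0 ≤ a) (hro : 0 < ro) :
    ∫⁻ ω, expNeg (∑' n, ENNReal.ofReal (a * N.bsRxOutside ro n ω)) ∂P =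
      ENNReal.ofReal (Real.exp (-(p.lam * (2 * Real.pi / (p.eta - 2) * ro ^ (2 - p.eta) *
        (a * p.pDl) * p.hyp (-(ro ^ (-p.eta) * (a * p.pDl))))))) := by
  have h1 := mul_nonneg ha p.pDl_pos.le
  have h2 := p.hyp_neg_nonneg (mul_nonneg (Real.rpow_nonneg hro.le (-p.eta)) h1)
  have h3 := p.lam_pos.le
  have h4 : 0 < p.eta - 2 := by linarith [p.two_lt_eta]
  rw [N.lintegral_expNeg_bs ha, p.lintegral_plane_outside hro h1, ← ENNReal.ofReal_mul h3,
    expNeg_ofReal (by positivity)]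

lemma lintegral_expNeg_bsAll [IsProbabilityMeasure P] {a : ℝ} (ha : 0 ≤ a) :
    ∫⁻ ω, expNeg (∑' n, ENNReal.ofReal (a * N.bsRx n ω)) ∂P =
      ENNReal.ofReal (Real.exp (-(p.lam * (2 * Real.pi ^ 2 / p.eta * (a * p.pDl) ^ (2 / p.eta) *
        (Real.sin (2 * Real.pi / p.eta))⁻¹)))) := by
  have h1 := mul_nonneg ha p.pDl_pos.le
  have h := N.lintegral_expNeg_bs ha (-1)
  simp only [bsRxOutside_neg_one] at h
  have hif : ∀ x : Plane, -1 < ‖x‖ := fun x => by linarith [norm_nonneg x]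
  simp only [hif, if_true] at h
  have hη := p.eta_pos
  have h3 := p.lam_pos.le
  have hsin : 0 ≤ Real.sin (2 * Real.pi / p.eta) := by
    refine Real.sin_nonneg_of_nonneg_of_le_pi (by positivity) ?_
    rw [div_le_iff₀ hη, mul_comm]
    exact mul_le_mul_of_nonneg_left p.two_lt_eta.le Real.pi_pos.le
  rw [h, p.lintegral_plane_all h1, ← ENNReal.ofReal_mul h3, expNeg_ofReal]
  positivity

/-! ### Interference from the users -/

open Classical in
/-- The received power, scaled by `a`, from a user at `x` whose distance to its base station is
`r` and whose channel gain is `h`. -/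
noncomputable def uePowerRx (p : CellParams) (a : ℝ) (x : Plane) (r h : ℝ) : ℝ≥0∞ :=
  ENNReal.ofReal (a * if p.invPower r * ‖x‖ ^ (-p.eta) < p.rho then
    p.invPower r * h * ‖x‖ ^ (-p.eta) else 0)

lemma measurable_uePowerRx (a : ℝ) :
    Measurable fun z : (Plane × ℝ) × ℝ => uePowerRx p a z.1.1 z.1.2 z.2 := by
  unfold uePowerRx
  refine ENNReal.measurable_ofReal.comp (measurable_const.mul (Measurable.ite ?_ ?_ ?_))
  · exact measurableSet_lt (by fun_prop) measurable_const
  · fun_prop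
  · fun_prop

lemma lintegral_expNeg_uePowerRx {a : ℝ} (ha : 0 ≤ a) (x : Plane) {r : ℝ} (hr : 0 < r) :
    ∫⁻ h, expNeg (uePowerRx p a x r h) ∂(expMeasure 1) = if r < ‖x‖ then
      ENNReal.ofReal (1 / (1 + a * p.invPower r * ‖x‖ ^ (-p.eta))) else 1 := by
  have := isProbabilityMeasure_expMeasure one_pos
  have hη := p.eta_pos
  have hρ := p.rho_pos
  have hinv : 0 ≤ p.invPower r := mul_nonneg hρ.le (Real.rpow_nonneg hr.le _)
  rcases (norm_nonneg x).eq_or_lt with h0 | h0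
  · simp [uePowerRx, ← h0, Real.zero_rpow (neg_ne_zero.2 hη.ne')]
  -- Channel inversion makes the admissibility condition geometric: the user must be farther from
  -- the origin than from its own base station.
  · have hiff : p.invPower r * ‖x‖ ^ (-p.eta) < p.rho ↔ r < ‖x‖ := by
      rw [CellParams.invPower, Real.rpow_neg h0.le, mul_assoc, ← div_eq_mul_inv,
        mul_lt_iff_lt_one_right hρ, div_lt_one (by positivity)]
      exact Real.rpow_lt_rpow_iff hr.le h0.le hη
    simp only [uePowerRx, hiff]
    split_ifs with hx
    · rw [← lintegral_expNeg_expMeasure (mul_nonneg (mul_nonneg ha hinv)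
        (Real.rpow_nonneg h0.le _))]
      refine lintegral_congr fun h => ?_
      congr 2
      ring
    · simp

lemma lintegral_expNeg_ue [IsProbabilityMeasure P] {a : ℝ} (ha : 0 ≤ a) :
    ∫⁻ ω, expNeg (∑' n, ENNReal.ofReal (a * N.ueRx n ω)) ∂P =
      ENNReal.ofReal (Real.exp (-(p.lam * (2 * Real.pi / (p.eta - 2) * (a * p.rho) *
        p.hyp (-(a * p.rho))) * (p.powerMoment / p.rho ^ (2 / p.eta))))) := by
  have := N.isProbabilityMeasure_linkDistLaw
  have := isProbabilityMeasure_expMeasure one_pos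
  have hη := p.eta_pos
  have hη2 : 0 < p.eta - 2 := by linarith [p.two_lt_eta]
  have hρ := p.rho_pos
  have hlam := p.lam_pos.le
  have haρ : 0 ≤ a * p.rho := mul_nonneg ha hρ.le
  have hF := p.hyp_neg_nonneg haρ
  set L := linkDistLaw p P N.bsLoc with hL
  set G : Plane → ℝ → ℝ≥0∞ := fun x r => ∫⁻ h, expNeg (uePowerRx p a x r h) ∂(expMeasure 1) with hG
  have hGm : Measurable (Function.uncurry G) :=
    Measurable.lintegral_prod_right' (f := fun z : (Plane × ℝ) × ℝ =>
      expNeg (uePowerRx p a z.1.1 z.1.2 z.2)) (measurable_expNeg.comp (measurable_uePowerRx a))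
  have hG1 : ∀ x r, G x r ≤ 1 := fun x r =>
    (lintegral_mono fun h => expNeg_le_one _).trans (by simp)
  have hmain : ∫⁻ ω, expNeg (∑' n, ENNReal.ofReal (a * N.ueRx n ω)) ∂P =
      expNeg (∫⁻ x, 1 - ∫⁻ r, G x r ∂L ∂p.intensity) :=
    N.ueLoc_poisson.lintegral_expNeg_marks₂ N.ueDist_measurable N.ueDist_law
      N.iIndepFun_ueDist N.indepFun_ueLoc_ueDist N.ueFade_measurable N.ueFade_law
      N.iIndepFun_ueFade N.indepFun_ueLocDist_ueFade (measurable_uePowerRx a)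
  have hsub : ∀ x, 1 - ∫⁻ r, G x r ∂L = ∫⁻ r, (1 - G x r) ∂L :=
    fun x => one_sub_lintegral hGm.of_uncurry_left (hG1 x)
  have hinner : ∀ r ∈ Ioc 0 p.rMax, ∫⁻ x, (1 - G x r) ∂p.intensity =
      ENNReal.ofReal (p.lam * (2 * Real.pi / (p.eta - 2) * (a * p.rho) *
        p.hyp (-(a * p.rho))) * r ^ 2) := by
    intro r hr
    have hr0 := hr.1
    have hinv : 0 ≤ p.invPower r := mul_nonneg hρ.le (Real.rpow_nonneg hr0.le _)
    -- The cancellation that frees the hypergeometric argument from `r`; the next identity leaves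
    -- only `r²` in the prefactor.
    have h1 : r ^ (-p.eta) * (a * p.invPower r) = a * p.rho := by
      rw [CellParams.invPower, Real.rpow_neg hr0.le]
      have : 0 < r ^ p.eta := by positivity
      field_simp
    have h2 : r ^ (2 - p.eta) * (a * p.invPower r) = r ^ 2 * (a * p.rho) := by
      rw [sub_eq_add_neg, Real.rpow_add hr0, mul_assoc, h1]
      norm_num
    simp only [hG, lintegral_expNeg_uePowerRx ha _ hr0]
    rw [CellParams.intensity, lintegral_smul_measure,
      p.lintegral_plane_outside hr0 (mul_nonneg ha hinv), h1, smul_eq_mul,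
      ← ENNReal.ofReal_mul hlam]
    congr 1
    rw [mul_assoc (2 * Real.pi / (p.eta - 2)), h2]
    ring
  -- Tonelli: the plane is integrated out first at fixed `r`, then `r²` is averaged over the link
  -- distance.
  rw [hmain, lintegral_congr hsub, lintegral_lintegral_swap
    (measurable_const.sub hGm).aemeasurable,
    lintegral_congr_ae ((ae_linkDistLaw N.bsLoc_poisson).mono hinner),
    lintegral_sq_linkDistLaw N.bsLoc_poisson (by positivity), expNeg_ofReal]
  have hm : 0 ≤ p.powerMoment / p.rho ^ (2 / p.eta) := by
    rw [← integral_sq_linkDistLaw N.bsLoc_poisson,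
      mul_div_cancel_left₀ _ (Real.rpow_pos_of_pos hρ _).ne']
    exact integral_nonneg fun r => sq_nonneg r
  positivity

/-! ### Convergence of the interference sums -/

lemma measurable_bsRxOutside (ro : ℝ) (n : ℕ) : Measurable (N.bsRxOutside ro n) := by
  have h : Measurable fun ω => N.bsLoc ω n :=
    (measurable_pi_apply n).comp N.bsLoc_poisson.measurable
  have := N.bsFade_measurable n
  unfold bsRxOutside bsRx
  exact Measurable.ite (measurableSet_lt measurable_const h.norm) (by fun_prop) measurable_const

lemma measurable_bsRx (n : ℕ) : Measurable (N.bsRx n) := by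
  have h : Measurable fun ω => N.bsLoc ω n :=
    (measurable_pi_apply n).comp N.bsLoc_poisson.measurable
  have := N.bsFade_measurable n
  unfold bsRx
  fun_prop

lemma measurable_ueRx (n : ℕ) : Measurable (N.ueRx n) := by
  have h : Measurable fun ω => N.ueLoc ω n :=
    (measurable_pi_apply n).comp N.ueLoc_poisson.measurable
  have := N.ueFade_measurable n
  have := N.ueDist_measurable n
  unfold ueRx uePower
  exact Measurable.ite (measurableSet_lt (by fun_prop) measurable_const) (by fun_prop)
    measurable_const

lemma ae_bsRxOutside_nonneg (ro : ℝ) : ∀ᵐ ω ∂P, ∀ n, 0 ≤ N.bsRxOutside ro n ω := by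
  filter_upwards [N.ae_bsFade_nonneg] with ω hω n
  have := hω n
  have := p.pDl_pos
  unfold bsRxOutside bsRx
  positivity

lemma ae_ueRx_nonneg [IsProbabilityMeasure P] : ∀ᵐ ω ∂P, ∀ n, 0 ≤ N.ueRx n ω := by
  filter_upwards [N.ae_ueFade_nonneg, N.ae_ueDist_mem] with ω hω hd n
  have h1 := hω n
  have h2 := (hd n).1
  have := p.rho_pos
  unfold ueRx uePower CellParams.invPower
  positivity

/-- The scales `1/(k+1)` tend to `0`, so the hypothesis makes the `[0, ∞]`-valued sum finite almost
surely; nonnegativity turns this into real summability. -/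
lemma ae_summable_of_tendsto [IsProbabilityMeasure P] {Y : ℕ → Ω → ℝ}
    (hY : ∀ n, Measurable (Y n)) (hpos : ∀ᵐ ω ∂P, ∀ n, 0 ≤ Y n ω)
    (h : Tendsto (fun k : ℕ => ∫⁻ ω, expNeg (∑' n, ENNReal.ofReal (1 / ((k : ℝ) + 1) * Y n ω)) ∂P)
      atTop (𝓝 1)) : ∀ᵐ ω ∂P, Summable fun n => Y n ω := by
  have hfin := ae_lt_top_of_tendsto_lintegral_expNeg (P := P)
    (Y := fun ω => ∑' n, ENNReal.ofReal (Y n ω))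
    (Measurable.tsum fun n => (hY n).ennreal_ofReal)
    (c := fun k => ENNReal.ofReal (1 / ((k : ℝ) + 1)))
    (fun k => (ENNReal.ofReal_pos.2 (by positivity)).ne') (by
      refine h.congr fun k => lintegral_congr fun ω => ?_
      rw [← ENNReal.tsum_mul_left]
      congr 2
      ext n
      rw [ENNReal.ofReal_mul (by positivity)])
  filter_upwards [hfin, hpos] with ω h1 h2
  have := ENNReal.summable_toReal h1.ne
  simpa only [ENNReal.toReal_ofReal (h2 _)] using this

lemma ae_summable_bsRx [IsProbabilityMeasure P] : ∀ᵐ ω ∂P, Summable fun n => N.bsRx n ω := by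
  refine ae_summable_of_tendsto N.measurable_bsRx ?_ ?_
  · simpa only [bsRxOutside_neg_one] using N.ae_bsRxOutside_nonneg (-1)
  · have hk : ∀ k : ℕ, (0 : ℝ) ≤ 1 / ((k : ℝ) + 1) := fun k => by positivity
    simp only [N.lintegral_expNeg_bsAll (hk _)]
    have h1 : Tendsto (fun k : ℕ => (1 / ((k : ℝ) + 1) * p.pDl) ^ (2 / p.eta)) atTop (𝓝 0) := by
      have := (tendsto_one_div_add_atTop_nhds_zero_nat (𝕜 := ℝ)).mul_const p.pDl
      rw [zero_mul] at this
      have h2 := this.rpow_const (p := 2 / p.eta) (Or.inr p.two_div_eta_pos.le)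
      rwa [Real.zero_rpow p.two_div_eta_pos.ne'] at h2
    have h3 : Tendsto (fun k : ℕ => -(p.lam * (2 * Real.pi ^ 2 / p.eta *
        (1 / ((k : ℝ) + 1) * p.pDl) ^ (2 / p.eta) * (Real.sin (2 * Real.pi / p.eta))⁻¹)))
        atTop (𝓝 0) := by
      have := (((h1.const_mul (2 * Real.pi ^ 2 / p.eta)).mul_const
        (Real.sin (2 * Real.pi / p.eta))⁻¹).const_mul p.lam).neg
      simpa using this
    have h4 := ENNReal.tendsto_ofReal ((Real.continuous_exp.tendsto 0).comp h3)
    simpa using h4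

lemma ae_summable_ueRx [IsProbabilityMeasure P] : ∀ᵐ ω ∂P, Summable fun n => N.ueRx n ω := by
  refine ae_summable_of_tendsto N.measurable_ueRx N.ae_ueRx_nonneg ?_
  have hk : ∀ k : ℕ, (0 : ℝ) ≤ 1 / ((k : ℝ) + 1) := fun k => by positivity
  simp only [N.lintegral_expNeg_ue (hk _)]
  have hη2 : 0 < p.eta - 2 := by linarith [p.two_lt_eta]
  have hρ := p.rho_pos
  have h0 : Tendsto (fun k : ℕ => 1 / ((k : ℝ) + 1) * p.rho) atTop (𝓝 0) := by
    simpa using (tendsto_one_div_add_atTop_nhds_zero_nat (𝕜 := ℝ)).mul_const p.rho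
  have h1 : Tendsto (fun k : ℕ => 1 / ((k : ℝ) + 1) * p.rho *
      p.hyp (-(1 / ((k : ℝ) + 1) * p.rho))) atTop (𝓝 0) := by
    refine squeeze_zero (fun k => ?_) (fun k => ?_) h0
    · exact mul_nonneg (by positivity) (p.hyp_neg_nonneg (by positivity))
    · exact mul_le_of_le_one_right (by positivity) (p.hyp_neg_le_one (by positivity))
  have h3 : Tendsto (fun k : ℕ => -(p.lam * (2 * Real.pi / (p.eta - 2) *
      (1 / ((k : ℝ) + 1) * p.rho) * p.hyp (-(1 / ((k : ℝ) + 1) * p.rho))) *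
      (p.powerMoment / p.rho ^ (2 / p.eta)))) atTop (𝓝 0) := by
    have := (((h1.const_mul (2 * Real.pi / (p.eta - 2))).const_mul p.lam).mul_const
      (p.powerMoment / p.rho ^ (2 / p.eta))).neg
    simpa [mul_assoc] using this
  have h4 := ENNReal.tendsto_ofReal ((Real.continuous_exp.tendsto 0).comp h3)
  simpa using h4


/-! ### Factorization of the Laplace transform -/

lemma ae_summable_bsRxOutside [IsProbabilityMeasure P] (ro : ℝ) :
    ∀ᵐ ω ∂P, Summable fun n => N.bsRxOutside ro n ω := by
  filter_upwards [N.ae_summable_bsRx, N.ae_bsRxOutside_nonneg ro, N.ae_bsRxOutside_nonneg (-1)]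
    with ω h1 h2 h3
  refine h1.of_nonneg_of_le h2 fun n => ?_
  have := h3 n
  rw [bsRxOutside_neg_one] at this
  unfold bsRxOutside
  split_ifs
  · exact le_rfl
  · exact this

lemma expNeg_tsum_ofReal {y : ℕ → ℝ} (hy : Summable y) (hpos : ∀ n, 0 ≤ y n) {a : ℝ} (ha : 0 ≤ a) :
    expNeg (∑' n, ENNReal.ofReal (a * y n)) = ENNReal.ofReal (Real.exp (-(a * ∑' n, y n))) := by
  rw [← ENNReal.ofReal_tsum_of_nonneg (fun n => mul_nonneg ha (hpos n)) (hy.mul_left a),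
    tsum_mul_left, expNeg_ofReal (mul_nonneg ha (tsum_nonneg hpos))]

/-- Serves both directions and both topologies: `A`, `B` are the gains of the two sums and `H` is
whatever the test cell contributes. Only measurability of `H` is required. -/
lemma integral_exp_neg_interference [IsProbabilityMeasure P] (ro : ℝ) {A B s : ℝ} (hA : 0 ≤ A)
    (hB : 0 ≤ B) (hs : 0 ≤ s) {H : (ℝ × ℝ) × (ℝ × ℝ) → ℝ} (hH : Measurable H) :
    ∫ ω, Real.exp (-(s * (A * (∑' n, N.bsRxOutside ro n ω) + B * (∑' n, N.ueRx n ω) +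
        H (N.cellData ω)))) ∂P =
      (∫⁻ ω, expNeg (∑' n, ENNReal.ofReal (s * A * N.bsRxOutside ro n ω)) ∂P).toReal *
      (∫⁻ ω, expNeg (∑' n, ENNReal.ofReal (s * B * N.ueRx n ω)) ∂P).toReal *
      ∫ ω, Real.exp (-(s * H (N.cellData ω))) ∂P := by
  set Φ : (ℕ → Plane) × (ℕ → ℝ) → ℝ≥0∞ :=
    fun z => expNeg (∑' n, bsPower p (s * A) ro (z.1 n) (z.2 n)) with hΦ
  set Ψ : (ℕ → Plane × ℝ) × (ℕ → ℝ) → ℝ≥0∞ :=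
    fun z => expNeg (∑' n, uePowerRx p (s * B) (z.1 n).1 (z.1 n).2 (z.2 n)) with hΨ
  set Θ : (ℝ × ℝ) × (ℝ × ℝ) → ℝ≥0∞ := fun z => ENNReal.ofReal (Real.exp (-(s * H z))) with hΘ
  have hΦm : Measurable Φ := measurable_expNeg.comp (Measurable.tsum fun n =>
    (measurable_bsPower (s * A) ro).comp
      (f := fun z : (ℕ → Plane) × (ℕ → ℝ) => (z.1 n, z.2 n)) (by fun_prop))
  have hΨm : Measurable Ψ := measurable_expNeg.comp (Measurable.tsum fun n =>
    (measurable_uePowerRx (s * B)).comp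
      (f := fun z : (ℕ → Plane × ℝ) × (ℕ → ℝ) => (z.1 n, z.2 n)) (by fun_prop))
  have hΘm : Measurable Θ := by fun_prop
  have hbs := N.measurable_bsData
  have hue := N.measurable_ueData
  have hcell := N.measurable_cellData
  -- Only almost sure: a real `tsum` has the value `0` when divergent, so summability and signs are
  -- both needed here.
  have hae : ∀ᵐ ω ∂P, ENNReal.ofReal (Real.exp (-(s * (A * (∑' n, N.bsRxOutside ro n ω) +
      B * (∑' n, N.ueRx n ω) + H (N.cellData ω))))) =
      Φ (N.bsData ω) * (Ψ (N.ueData ω) * Θ (N.cellData ω)) := by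
    filter_upwards [N.ae_summable_bsRxOutside ro, N.ae_bsRxOutside_nonneg ro, N.ae_summable_ueRx,
      N.ae_ueRx_nonneg] with ω h1 h2 h3 h4
    have e1 : Φ (N.bsData ω) = _ := expNeg_tsum_ofReal h1 h2 (mul_nonneg hs hA)
    have e2 : Ψ (N.ueData ω) = _ := expNeg_tsum_ofReal h3 h4 (mul_nonneg hs hB)
    rw [e1, e2, hΘ, ← ENNReal.ofReal_mul (Real.exp_nonneg _),
      ← ENNReal.ofReal_mul (Real.exp_nonneg _), ← Real.exp_add, ← Real.exp_add]
    congr 2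
    ring
  have hfac : ∫⁻ ω, Φ (N.bsData ω) * (Ψ (N.ueData ω) * Θ (N.cellData ω)) ∂P =
      (∫⁻ ω, Φ (N.bsData ω) ∂P) * ((∫⁻ ω, Ψ (N.ueData ω) ∂P) * ∫⁻ ω, Θ (N.cellData ω) ∂P) := by
    have h1 := lintegral_mul_eq_lintegral_mul_lintegral_of_indepFun (μ := P)
      (hΦm.comp hbs) ((hΨm.comp (hue.comp measurable_id)).mul (hΘm.comp hcell))
      (N.indepFun_bsData.comp (φ := Φ)
        (ψ := fun z : ((ℕ → Plane × ℝ) × (ℕ → ℝ)) × ((ℝ × ℝ) × (ℝ × ℝ)) => Ψ z.1 * Θ z.2)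
        hΦm ((hΨm.comp measurable_fst).mul (hΘm.comp measurable_snd)))
    have h2 := lintegral_mul_eq_lintegral_mul_lintegral_of_indepFun (μ := P)
      (hΨm.comp hue) (hΘm.comp hcell) (N.indepFun_ueData.comp hΨm hΘm)
    exact h1.trans (congrArg _ h2)
  rw [integral_eq_lintegral_of_nonneg_ae (.of_forall fun ω => Real.exp_nonneg _),
    lintegral_congr_ae hae, hfac, ENNReal.toReal_mul, ENNReal.toReal_mul, ← mul_assoc,
    integral_eq_lintegral_of_nonneg_ae (.of_forall fun ω => Real.exp_nonneg _)]
  · rfl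
  · exact (Real.measurable_exp.comp (hH.comp hcell |>.const_mul s).neg).aestronglyMeasurable
  · have h1 : Measurable fun ω => ∑' n, N.bsRxOutside ro n ω :=
      Measurable.tsum fun n => N.measurable_bsRxOutside ro n
    have h2 : Measurable fun ω => ∑' n, N.ueRx n ω := Measurable.tsum fun n => N.measurable_ueRx n
    have h3 := hH.comp hcell
    exact (Real.measurable_exp.comp ((((h1.const_mul A).add (h2.const_mul B)).add
      h3).const_mul s).neg).aestronglyMeasurable

/-! ### Self-interference -/

lemma integral_exp_neg_siGain (c : ℝ) :
    ∫ ω, Real.exp (-(c * N.siGain ω)) ∂P =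
      ∫ h in Ici (0 : ℝ), Real.exp (-(c * h)) ∂p.siLaw := by
  have h := N.siGain_law.integral_comp (f := fun h => Real.exp (-(c * h)))
    (Measurable.aestronglyMeasurable (by fun_prop))
  -- The attenuation law is carried by `[0, ∞)`, so restricting it changes nothing.
  have hr : p.siLaw.restrict (Ici 0) = p.siLaw :=
    Measure.restrict_eq_self_of_ae_mem p.siLaw_nonneg
  rw [hr]
  exact h

/-! ### Intra-cell interference -/

lemma measurable_polar (x : Plane) :
    Measurable fun z : ℝ × ℝ => x + z.1 • (!₂[Real.cos z.2, Real.sin z.2] : Plane) := by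
  refine Continuous.measurable (continuous_const.add (continuous_fst.smul
    ((PiLp.continuous_toLp 2 _).comp (continuous_pi fun i => ?_))))
  fin_cases i
  · exact Real.continuous_cos.comp continuous_snd
  · exact Real.continuous_sin.comp continuous_snd

/-- Law of cosines, with `t` the argument of `-x`, the direction of the origin seen from `x`. Only
the existence of `t` matters, since the direction is later averaged uniformly. -/
lemma exists_polar (x : Plane) :
    ∃ t : ℝ, ∀ r θ : ℝ, ‖x + r • (!₂[Real.cos θ, Real.sin θ] : Plane)‖ ^ 2 =
      ‖x‖ ^ 2 + r ^ 2 - 2 * ‖x‖ * r * Real.cos (θ - t) := by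
  set z : ℂ := ⟨-x 0, -x 1⟩ with hz
  have hnorm : ‖x‖ = ‖z‖ := by
    rw [EuclideanSpace.norm_eq, Complex.norm_eq_sqrt_sq_add_sq]
    simp [hz, Fin.sum_univ_two]
  have h1 : ‖x‖ * Real.cos z.arg = -x 0 := by rw [hnorm, Complex.norm_mul_cos_arg]
  have h2 : ‖x‖ * Real.sin z.arg = -x 1 := by rw [hnorm, Complex.norm_mul_sin_arg]
  refine ⟨z.arg, fun r θ => ?_⟩
  have h3 : ‖x‖ ^ 2 = x 0 ^ 2 + x 1 ^ 2 := by
    rw [EuclideanSpace.norm_sq_eq]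
    simp [Fin.sum_univ_two]
  rw [h3, EuclideanSpace.norm_sq_eq, Real.cos_sub]
  simp only [Fin.sum_univ_two, PiLp.add_apply, PiLp.smul_apply, smul_eq_mul, Real.norm_eq_abs,
    sq_abs, Matrix.cons_val_zero, Matrix.cons_val_one]
  linear_combination 2 * r * Real.cos θ * h1 + 2 * r * Real.sin θ * h2 +
    r ^ 2 * Real.cos_sq_add_sin_sq θ

/-- Periodicity moves the window to `[-π, π]`, removing `t`, and evenness of the cosine folds it
onto `[0, π]`. The bound on `f` gives the integrability needed to split. -/
lemma integral_comp_cos_sub {f : ℝ → ℝ} (hf : Measurable f) {C : ℝ} (hC : ∀ x, ‖f x‖ ≤ C) (t : ℝ) :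
    ∫ θ in (0 : ℝ)..2 * Real.pi, f (Real.cos (θ - t)) =
      2 * ∫ θ in (0 : ℝ)..Real.pi, f (Real.cos θ) := by
  have hint : ∀ a b : ℝ, IntervalIntegrable (fun θ => f (Real.cos θ)) volume a b := fun a b =>
    (intervalIntegrable_const (c := C)).mono_fun
      (Measurable.aestronglyMeasurable (hf.comp Real.measurable_cos))
      (.of_forall fun θ => (hC _).trans (le_abs_self C))
  have hper : Function.Periodic (fun θ => f (Real.cos θ)) (2 * Real.pi) := fun θ => by
    simp
  have h1 := intervalIntegral.integral_comp_sub_right (a := 0) (b := 2 * Real.pi)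
    (fun θ => f (Real.cos θ)) t
  have h2 := hper.intervalIntegral_add_eq (0 - t) (-Real.pi)
  rw [h1, show 2 * Real.pi - t = 0 - t + 2 * Real.pi by ring, h2,
    show -Real.pi + 2 * Real.pi = Real.pi by ring,
    ← intervalIntegral.integral_add_adjacent_intervals (hint (-Real.pi) 0) (hint 0 Real.pi)]
  have h3 := intervalIntegral.integral_comp_neg (a := 0) (b := Real.pi)
    (fun θ => f (Real.cos θ))
  simp only [Real.cos_neg, neg_zero] at h3
  rw [← h3]
  ring

lemma integral_exp_neg_cellRx [IsProbabilityMeasure P] (xo : Plane) {s : ℝ} (hs : 0 ≤ s) :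
    ∫ ω, Real.exp (-(s * (p.crossGain .dl * N.cellRx xo ω))) ∂P = p.U1 .threeNode ‖xo‖ s := by
  have hC : 0 ≤ p.crossGain .dl := sq_nonneg _
  have hρ := p.rho_pos
  have hη := p.eta_pos
  set L := linkDistLaw p P N.bsLoc with hL
  have hLp : IsProbabilityMeasure L := N.isProbabilityMeasure_linkDistLaw
  have hexp := isProbabilityMeasure_expMeasure one_pos
  have hk : 0 ≤ s * p.crossGain .dl := mul_nonneg hs hC
  set k := s * p.crossGain .dl with hkdef
  set V : Measure ℝ := ProbabilityTheory.cond volume (Ico 0 (2 * Real.pi)) with hV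
  have hVlaw : HasLaw N.cellAngle V P := ⟨N.cellAngle_measurable.aemeasurable, N.cellAngle_law⟩
  have hVp : IsProbabilityMeasure V :=
    hVlaw.map_eq ▸ Measure.isProbabilityMeasure_map N.cellAngle_measurable.aemeasurable
  have hDA : HasLaw (fun ω => (N.cellDist ω, N.cellAngle ω)) (L.prod V) P :=
    (indepFun_iff_hasLaw_prodMk_prod N.cellDist_law hVlaw).1 N.indepFun_cellDist_cellAngle
  have hDAF : HasLaw (fun ω => ((N.cellDist ω, N.cellAngle ω), N.cellFade ω))
      ((L.prod V).prod (expMeasure 1)) P :=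
    (indepFun_iff_hasLaw_prodMk_prod hDA N.cellFade_law).1 N.indepFun_cellFade
  set Q : ℝ → ℝ → ℝ := fun r θ => p.invPower r *
    ‖xo + r • (!₂[Real.cos θ, Real.sin θ] : Plane)‖ ^ (-p.eta) with hQ
  have hQm : Measurable (Function.uncurry Q) :=
     (p.measurable_invPower.comp measurable_fst).mul ((measurable_polar xo).norm.pow_const _)
  have hQ0 : ∀ r, 0 < r → ∀ θ, 0 ≤ Q r θ := fun r hr θ =>
    mul_nonneg (mul_nonneg hρ.le (Real.rpow_nonneg hr.le _)) (Real.rpow_nonneg (norm_nonneg _) _)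
  set g : (ℝ × ℝ) × ℝ → ℝ := fun z => Real.exp (-(k * Q z.1.1 z.1.2 * z.2)) with hg
  have hgm : Measurable g := by
    have : Measurable fun z : (ℝ × ℝ) × ℝ => Q z.1.1 z.1.2 := hQm.comp measurable_fst
    exact Real.measurable_exp.comp ((this.const_mul k).mul measurable_snd).neg
  have hL_ae : ∀ᵐ r ∂L, r ∈ Ioc 0 p.rMax := ae_linkDistLaw N.bsLoc_poisson
  -- averaging over the channel gain
  have hfade : ∫ ω, Real.exp (-(s * (p.crossGain .dl * N.cellRx xo ω))) ∂P =
      ∫ z, 1 / (1 + k * Q z.1 z.2) ∂(L.prod V) := by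
    have h1 : ∫ ω, Real.exp (-(s * (p.crossGain .dl * N.cellRx xo ω))) ∂P =
        ∫ z, g z ∂((L.prod V).prod (expMeasure 1)) := by
      rw [← hDAF.integral_comp hgm.aestronglyMeasurable]
      refine integral_congr_ae (.of_forall fun ω => ?_)
      simp only [hg, hQ, cellRx, cellUserLoc, Function.comp, hkdef]
      congr 1
      ring
    have hpos : ∀ᵐ z ∂(L.prod V), 0 ≤ Q z.1 z.2 :=
      (Measure.quasiMeasurePreserving_fst.ae hL_ae).mono fun z hz => hQ0 _ hz.1 _
    rw [h1, integral_eq_lintegral_of_nonneg_ae (.of_forall fun z => Real.exp_nonneg _)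
      hgm.aestronglyMeasurable, lintegral_prod _ hgm.ennreal_ofReal.aemeasurable,
      integral_eq_lintegral_of_nonneg_ae]
    · congr 1
      refine lintegral_congr_ae (hpos.mono fun z hz => ?_)
      have hkQ : 0 ≤ k * Q z.1 z.2 := mul_nonneg hk hz
      simp only
      rw [← lintegral_expNeg_expMeasure hkQ]
      refine lintegral_congr_ae (ae_nonneg_expMeasure.mono fun h hh => ?_)
      simp only [hg]
      rw [expNeg_ofReal (mul_nonneg hkQ hh)]
    · exact hpos.mono fun z hz => by
        have hkQ : 0 ≤ k * Q z.1 z.2 := mul_nonneg hk hz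
        simp only [Pi.zero_apply]
        positivity
    · exact (measurable_const.div (measurable_const.add (hQm.const_mul k))).aestronglyMeasurable
  have hint : Integrable (fun z : ℝ × ℝ => 1 / (1 + k * Q z.1 z.2)) (L.prod V) := by
    refine .of_bound
      (measurable_const.div (measurable_const.add (hQm.const_mul k))).aestronglyMeasurable 1 ?_
    refine (Measure.quasiMeasurePreserving_fst.ae hL_ae).mono fun z hz => ?_
    have hkQ : 0 ≤ k * Q z.1 z.2 := mul_nonneg hk (hQ0 _ hz.1 _)
    rw [Real.norm_of_nonneg (by positivity)]
    exact div_le_self zero_le_one (by linarith)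
  obtain ⟨t, ht⟩ := exists_polar xo
  -- averaging over the direction
  have hangle : ∀ r, 0 < r → ∫ θ, 1 / (1 + k * Q r θ) ∂V =
      ∫ θ in (0 : ℝ)..Real.pi, 1 / (Real.pi + Real.pi * s * p.crossGain .dl * p.rho *
        (1 + (‖xo‖ / r) ^ 2 - 2 * (‖xo‖ / r) * Real.cos θ) ^ (-p.eta / 2)) := by
    intro r hr
    -- The absolute value makes `f` bounded by `1` at every real `c`, as `integral_comp_cos_sub`
    -- asks; at cosines the base is already nonnegative.
    set f : ℝ → ℝ := fun c => 1 / (1 + k * p.rho *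
      |1 + (‖xo‖ / r) ^ 2 - 2 * (‖xo‖ / r) * c| ^ (-p.eta / 2)) with hf
    have hbase : ∀ c : ℝ, 0 ≤ k * p.rho *
        |1 + (‖xo‖ / r) ^ 2 - 2 * (‖xo‖ / r) * c| ^ (-p.eta / 2) := fun c => by positivity
    have hfm : Measurable f := by fun_prop
    have hfb : ∀ c, ‖f c‖ ≤ 1 := fun c => by
      have := hbase c
      rw [hf, Real.norm_of_nonneg (by positivity)]
      exact div_le_self zero_le_one (by linarith)
    have hnonneg : ∀ θ, 0 ≤ 1 + (‖xo‖ / r) ^ 2 - 2 * (‖xo‖ / r) * Real.cos θ := fun θ => by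
      nlinarith [sq_nonneg (‖xo‖ / r - Real.cos θ), Real.cos_sq_le_one θ]
    have hQf : ∀ θ, 1 / (1 + k * Q r θ) = f (Real.cos (θ - t)) := by
      intro θ
      have h1 : ‖xo + r • (!₂[Real.cos θ, Real.sin θ] : Plane)‖ ^ 2 =
          r ^ 2 * (1 + (‖xo‖ / r) ^ 2 - 2 * (‖xo‖ / r) * Real.cos (θ - t)) := by
        rw [ht]
        field_simp
        ring
      have h2 : Q r θ = p.rho *
          (1 + (‖xo‖ / r) ^ 2 - 2 * (‖xo‖ / r) * Real.cos (θ - t)) ^ (-p.eta / 2) := by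
        have h3 : ‖xo + r • (!₂[Real.cos θ, Real.sin θ] : Plane)‖ ^ (-p.eta) =
            (‖xo + r • (!₂[Real.cos θ, Real.sin θ] : Plane)‖ ^ 2) ^ (-p.eta / 2) := by
          rw [← Real.rpow_natCast, ← Real.rpow_mul (norm_nonneg _)]
          congr 1
          push_cast
          ring
        simp only [hQ]
        rw [h3, h1, Real.mul_rpow (sq_nonneg r) (hnonneg _), CellParams.invPower,
          ← Real.rpow_natCast r 2, ← Real.rpow_mul hr.le, mul_assoc p.rho, ← mul_assoc (r ^ p.eta),
          ← Real.rpow_add hr]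
        -- The `r^η` of channel inversion cancels the `r^(-η)` scaled out of the path loss.
        rw [show p.eta + ((2 : ℕ) : ℝ) * (-p.eta / 2) = 0 by push_cast; ring, Real.rpow_zero,
          one_mul]
      rw [h2, hf]
      simp only
      rw [abs_of_nonneg (hnonneg _), mul_assoc k]
    simp only [hQf]
    -- The uniform density `1/(2π)` times the folding factor `2` is `1/π`, which becomes the `π` in
    -- the denominator of `U1`.
    rw [hV, ProbabilityTheory.cond, integral_smul_measure, Real.volume_Ico, sub_zero,
      integral_Ico_eq_integral_Ioc, ← intervalIntegral.integral_of_le (by positivity),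
      integral_comp_cos_sub hfm hfb, ENNReal.toReal_inv, ENNReal.toReal_ofReal (by positivity),
      smul_eq_mul, ← mul_assoc, ← intervalIntegral.integral_const_mul]
    refine intervalIntegral.integral_congr fun θ _ => ?_
    simp only [hf]
    have h4 := hbase (Real.cos θ)
    rw [abs_of_nonneg (hnonneg θ)] at h4 ⊢
    set Y := (1 + (‖xo‖ / r) ^ 2 - 2 * (‖xo‖ / r) * Real.cos θ) ^ (-p.eta / 2)
    have h5 : Real.pi + Real.pi * s * p.crossGain .dl * p.rho * Y =
        Real.pi * (1 + k * p.rho * Y) := by rw [hkdef]; ring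
    rw [h5]
    have := Real.pi_pos
    have : 0 < 1 + k * p.rho * Y := by linarith
    field_simp
  rw [hfade, integral_prod _ hint, integral_congr_ae
    (hL_ae.mono fun r hr => hangle r hr.1), hL, integral_linkDistLaw N.bsLoc_poisson]
  simp only [CellParams.U1, ← intervalIntegral.integral_const_mul, mul_one_div]

end CellNetwork

end LaplaceTransform

/-! ### Assembly of the closed forms -/

theorem lemma1 (p : CellParams) {Ω : Type*} [MeasurableSpace Ω] (P : Measure Ω)
    [IsProbabilityMeasure P] (N : CellNetwork p P) :
    -- the distance of an active user to its base station has density `f_R` on `(0, R_M]`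
    (linkDistLaw p P N.bsLoc = ((volume : Measure ℝ).restrict (Set.Ioc 0 p.rMax)).withDensity
      (fun r => ENNReal.ofReal (p.distDensity r))) ∧
    -- the power moment
    (∀ n, ∫ ω, N.uePower n ω ^ (2 / p.eta) ∂P = p.powerMoment) ∧
    -- the aggregate interference is almost surely finite
    (∀ᵐ ω ∂P, Summable (fun n => N.bsRx n ω) ∧ Summable (fun n => N.ueRx n ω)) ∧
    -- downlink, for a serving base station at `xo`
    (∀ (τ : Topology) (xo : Plane), xo ≠ 0 → ∀ s : ℝ, 0 ≤ s →
      laplaceTransform (N.interferenceDl τ xo) P s =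
        Real.exp (-2 * Real.pi * p.lam / (p.eta - 2) * ‖xo‖ ^ (2 - p.eta) * p.intraGain .dl *
            s * p.pDl * p.hyp (-(‖xo‖ ^ (-p.eta) * p.pDl * p.intraGain .dl * s))) *
          Real.exp (-2 * Real.pi * p.lam * p.rho ^ (1 - 2 / p.eta) / (p.eta - 2) *
            p.powerMoment * p.crossGain .dl * s * p.hyp (-(p.rho * p.crossGain .dl * s))) *
          p.U1 τ ‖xo‖ s * p.U2 τ ‖xo‖ s) ∧
    -- uplink
    (∀ s : ℝ, 0 ≤ s →
      laplaceTransform N.interferenceUl P s =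
        Real.exp (-2 * Real.pi * p.lam * p.rho ^ (1 - 2 / p.eta) / (p.eta - 2) *
            p.powerMoment * p.intraGain .ul * s * p.hyp (-(p.rho * p.intraGain .ul * s))) *
          Real.exp (-(2 * Real.pi ^ 2 * p.lam / p.eta) *
            (s * p.crossGain .ul * p.pDl) ^ (2 / p.eta) *
            (Real.sin (2 * Real.pi / p.eta))⁻¹) *
          p.U3 s) := by
  have hη := p.eta_pos
  have hρ := p.rho_pos
  -- The quotient `ρ / ρ^(2/η)` is merged into `ρ^(1-2/η)`; both directions use this form, with
  -- different gains.
  have hue : ∀ {a : ℝ}, 0 ≤ a → (∫⁻ ω, expNeg (∑' n, ENNReal.ofReal (a * N.ueRx n ω)) ∂P).toReal =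
      Real.exp (-2 * Real.pi * p.lam * p.rho ^ (1 - 2 / p.eta) / (p.eta - 2) *
        p.powerMoment * a * p.hyp (-(p.rho * a))) := by
    intro a ha
    rw [N.lintegral_expNeg_ue ha, ENNReal.toReal_ofReal (Real.exp_nonneg _), Real.rpow_sub hρ,
      Real.rpow_one, mul_comm a p.rho]
    congr 1
    ring
  refine ⟨linkDistLaw_eq N.bsLoc_poisson, fun n => ?_, ?_, fun τ xo hxo s hs => ?_, fun s hs => ?_⟩
  · have h1 := (N.ueDist_law n).integral_comp (f := fun r => p.invPower r ^ (2 / p.eta))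
      ((p.measurable_invPower.pow_const _).aestronglyMeasurable)
    refine h1.trans ?_
    rw [← integral_sq_linkDistLaw N.bsLoc_poisson, ← integral_const_mul]
    refine integral_congr_ae ((ae_linkDistLaw N.bsLoc_poisson).mono fun r hr => ?_)
    have hr0 := hr.1
    simp only [CellParams.invPower]
    rw [Real.mul_rpow hρ.le (by positivity), ← Real.rpow_mul hr0.le, mul_div_cancel₀ _ hη.ne',
      Real.rpow_two]
  · filter_upwards [N.ae_summable_bsRx, N.ae_summable_ueRx] with ω h1 h2 using ⟨h1, h2⟩
  · have hI : 0 ≤ p.intraGain .dl := sq_nonneg _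
    have hC : 0 ≤ p.crossGain .dl := sq_nonneg _
    have hbs : (∫⁻ ω, expNeg (∑' n, ENNReal.ofReal
        (s * p.intraGain .dl * N.bsRxOutside ‖xo‖ n ω)) ∂P).toReal =
        Real.exp (-2 * Real.pi * p.lam / (p.eta - 2) * ‖xo‖ ^ (2 - p.eta) * p.intraGain .dl *
          s * p.pDl * p.hyp (-(‖xo‖ ^ (-p.eta) * p.pDl * p.intraGain .dl * s))) := by
      rw [N.lintegral_expNeg_bsOutside (mul_nonneg hs hI) (norm_pos_iff.2 hxo),
        ENNReal.toReal_ofReal (Real.exp_nonneg _),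
        show ‖xo‖ ^ (-p.eta) * (s * p.intraGain .dl * p.pDl) =
          ‖xo‖ ^ (-p.eta) * p.pDl * p.intraGain .dl * s by ring]
      congr 1
      ring
    have hue' := hue (mul_nonneg hs hC)
    rw [← mul_assoc p.rho, mul_right_comm p.rho, ← mul_assoc _ s, mul_right_comm _ s] at hue'
    cases τ with
    | twoNode =>
      have h := N.integral_exp_neg_interference ‖xo‖ hI hC hs
        (H := fun z => p.beta .dl * z.2.2 * p.invPower ‖xo‖ * p.crossGain .dl) (by fun_prop)
      refine h.trans ?_
      rw [hbs, hue', CellParams.U1, mul_one, CellParams.U2]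
      congr 1
      have h2 := N.integral_exp_neg_siGain
        (s * p.beta .dl * p.invPower ‖xo‖ * p.crossGain .dl)
      refine Eq.trans ?_ (h2.trans ?_)
      · refine integral_congr_ae (.of_forall fun ω => ?_)
        simp only [CellNetwork.cellData]
        congr 1
        ring
      · refine integral_congr_ae (.of_forall fun x => ?_)
        simp only [CellParams.invPower]
        congr 1
        ring
    | threeNode =>
      have hm : Measurable fun z : (ℝ × ℝ) × (ℝ × ℝ) => p.crossGain .dl * (p.invPower z.1.1 *
          z.2.1 * ‖xo + z.1.1 • (!₂[Real.cos z.1.2, Real.sin z.1.2] : Plane)‖ ^ (-p.eta)) :=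
        (((p.measurable_invPower.comp (measurable_fst.comp measurable_fst)).mul
          (measurable_fst.comp measurable_snd)).mul
          (((CellNetwork.measurable_polar xo).comp measurable_fst).norm.pow_const _)).const_mul _
      have h := N.integral_exp_neg_interference ‖xo‖ hI hC hs hm
      refine h.trans ?_
      rw [hbs, hue', CellParams.U2, mul_one, ← N.integral_exp_neg_cellRx xo hs]
      rfl
  · have hI : 0 ≤ p.intraGain .ul := sq_nonneg _
    have hC : 0 ≤ p.crossGain .ul := sq_nonneg _
    -- In the uplink the gains exchange roles: the base stations carry the cross gain with no
    -- excluded disc, the users the intra-mode gain.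
    have h := N.integral_exp_neg_interference (-1) hC hI hs
      (H := fun z => p.beta .ul * z.2.2 * p.pDl * p.crossGain .ul) (by fun_prop)
    simp only [CellNetwork.bsRxOutside_neg_one] at h
    rw [N.lintegral_expNeg_bsAll (mul_nonneg hs hC), hue (mul_nonneg hs hI),
      ENNReal.toReal_ofReal (Real.exp_nonneg _)] at h
    have h2 := N.integral_exp_neg_siGain (s * p.beta .ul * p.pDl * p.crossGain .ul)
    have h3 : ∫ ω, Real.exp (-(s * (p.beta .ul * (N.cellData ω).2.2 * p.pDl *
        p.crossGain .ul))) ∂P = p.U3 s := by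
      refine Eq.trans ?_ (h2.trans ?_)
      · refine integral_congr_ae (.of_forall fun ω => ?_)
        simp only [CellNetwork.cellData]
        congr 1
        ring
      · refine integral_congr_ae (.of_forall fun x => ?_)
        simp only
        congr 1
        ring
    rw [h3] at h
    refine Eq.trans ?_ (h.trans ?_)
    · refine integral_congr_ae (.of_forall fun ω => ?_)
      simp only [CellNetwork.interferenceUl, CellNetwork.cellData]
      congr 3
      ring
    · rw [← mul_assoc p.rho, mul_right_comm p.rho]
      rw [mul_comm (Real.exp _) (Real.exp _)]
      congr 3
      · ring
      · ring
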